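/- An additive arithmetical semigroup is a free abelian semigroup $\mathcal G$ with identity $1$, generated by a countable set $\mathcal P$ of primes (every element is a finite product of primes, uniquely up to order), together with a degree map $\partial:\mathcal G\to\{0,1,2,\dots\}$ such that $\partial(1)=0$, $\partial(p)>0$ for $p\in\mathcal P$, $\partial(gh)=\partial(g)+\partial(h)$, and $\{g\in\mathcal G:\partial(g)\le x\}$ is finite for every $x>0$. Let $G(n)$ be the number of elements of degree $n$, let $\mathcal G_n$ be the finite set of elements of degree at most $n$, let $\Omega(g)$ be the number of prime factors of $g$ counted with multiplicity, and put $$\bar\Lambda(n)=\sum_{\substack{p\in\mathcal P,\ r\ge1\\ \partial(p^r)=n}}\partial(p).$$ **Theorem.** Let $\mathcal G$ be an additive arithmetical semigroup of Axiom $\mathcal A^\#$ type, i.e. there are constants $c>0$, $q>1$, $0\le\eta<1$ with $$G(n)=cq^n+O(q^{\eta n})\qquad(n\to\infty),$$ and assume that $\mathcal G$ admits a Prime Number Theorem of classical type, i.e. for some $\theta$ with $\eta<\theta<1$, $$\bar\Lambda(n)=q^n+O(q^{\theta n})\qquad(n\to\infty).$$ Let $X$ be a compact metric space, let $T:X\to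 X$ be continuous, and let $\mu$ be the unique $T$-invariant Borel probability measure on $X$ (that is, $(X,\mu,T)$ is uniquely ergodic). Then for every continuous compactly supported $F:\mathbb R\to\mathbb C$, every $x\in X$ and every continuous $f:X\to\mathbb C$, $$\lim_{n\to\infty}\frac1{|\mathcal G_n|}\sum_{g\in\mathcal G_n}F\Big(\frac{\Omega(g)-\log n}{\sqrt{\log n}}\Big)f(T^{\Omega(g)}x)=\Big(\frac1{\sqrt{2\pi}}\int_{-\infty}^\infty F(t)e^{-t^2/2}\,dt\Big)\Big(\int_X f\,d\mu\Big).$$ In particular, for every $x\in X$ and every continuous $f:X\to\mathbb C$, $$\lim_{n\to\infty}\frac1{|\mathcal G_n|}\sum_{g\in\mathcal G_n}f(T^{\Omega(g)}x)=\int_X f\,d\mu.$$ -/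

import Mathlib

open Filter Topology MeasureTheory Asymptotics

/-- An additive arithmetical semigroup structure on a commutative monoid `G`: a countable set of
primes freely generating `G` (every element is the product of a unique finite multiset of primes),
together with an `ℕ`-valued additive degree, positive on primes, with finitely many elements of
degree at most any given bound. -/
structure AdditiveArithmeticalSemigroup (G : Type*) [CommMonoid G] where
  primes : Set G
  countable_primes : primes.Countable
  unique_factorization : ∀ g : G, ∃! s : Multiset G, (∀ p ∈ s, p ∈ primes) ∧ s.prod = g
  degree : G → ℕ
  degree_one : degree 1 = 0
  degree_prime_pos : ∀ p ∈ primes, 0 < degree p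
  degree_mul : ∀ g h : G, degree (g * h) = degree g + degree h
  finite_degree_le : ∀ n : ℕ, {g : G | degree g ≤ n}.Finite

namespace AdditiveArithmeticalSemigroup

variable {G : Type*} [CommMonoid G] (S : AdditiveArithmeticalSemigroup G)

/-- The multiset of prime factors of `g`, with multiplicities. -/
noncomputable def primeFactors (g : G) : Multiset G :=
  (S.unique_factorization g).choose

/-- `Ω(g)`: the number of prime factors of `g`, counted with multiplicities. -/
noncomputable def bigOmega (g : G) : ℕ :=
  Multiset.card (S.primeFactors g)

/-- The finite set of elements of degree at most `n`. -/
noncomputable def degreeLE (n : ℕ) : Finset G :=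
  (S.finite_degree_le n).toFinset

/-- The number of elements of degree exactly `n`. -/
noncomputable def count (n : ℕ) : ℕ :=
  {g : G | S.degree g = n}.ncard

theorem degree_pow (g : G) (r : ℕ) : S.degree (g ^ r) = r * S.degree g := by
  induction r with
  | zero => simp [S.degree_one]
  | succ r ih => rw [pow_succ, S.degree_mul, ih, Nat.succ_mul]

theorem finite_primePowers (n : ℕ) :
    {x : G × ℕ | x.1 ∈ S.primes ∧ 1 ≤ x.2 ∧ S.degree (x.1 ^ x.2) = n}.Finite := by
  refine ((S.finite_degree_le n).prod (Set.finite_Iic n)).subset ?_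
  rintro ⟨p, r⟩ ⟨hp, hr, h⟩
  have hd := S.degree_prime_pos p hp
  simp only [degree_pow] at h hr hd
  simp only [Set.mem_prod, Set.mem_ofPred_eq, Set.mem_Iic]
  constructor <;> nlinarith

/-- The Chebyshev-type function: the sum of `∂(p)` over primes `p` and exponents `r ≥ 1` with
`∂(p ^ r) = n`. -/
noncomputable def chebyshev (n : ℕ) : ℕ :=
  ∑ x ∈ (S.finite_primePowers n).toFinset, S.degree x.1

/-- `c > 0`, `q > 1`, `0 ≤ η < 1` and `G(n) = c q ^ n + O(q ^ (η n))`. -/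
def IsAxiomASharp (c q η : ℝ) : Prop :=
  0 < c ∧ 1 < q ∧ 0 ≤ η ∧ η < 1 ∧
    (fun n : ℕ => (S.count n : ℝ) - c * q ^ n) =O[atTop] (fun n : ℕ => q ^ (η * (n : ℝ)))

/-- The Prime Number Theorem of classical type: the Chebyshev-type function is
`q ^ n + O(q ^ (θ n))` for some `η < θ < 1`. -/
def HasClassicalPNT (q η : ℝ) : Prop :=
  ∃ θ : ℝ, η < θ ∧ θ < 1 ∧
    (fun n : ℕ => (S.chebyshev n : ℝ) - q ^ n) =O[atTop] (fun n : ℕ => q ^ (θ * (n : ℝ)))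

end AdditiveArithmeticalSemigroup

/-- `(X, μ, T)` is uniquely ergodic: `T` is continuous and `μ` is the only `T`-invariant Borel
probability measure. -/
structure IsUniquelyErgodic {X : Type*} [TopologicalSpace X] [MeasurableSpace X]
    (μ : Measure X) (T : X → X) : Prop where
  continuous : Continuous T
  isProbabilityMeasure : IsProbabilityMeasure μ
  invariant : MeasurePreserving T μ μ
  unique : ∀ ν : Measure X, IsProbabilityMeasure ν → MeasurePreserving T ν ν → ν = μ

/-! A law on `ℕ` is encoded by its generating polynomial, and `length` is then the total variation
norm. Weighting `g` by `X ^ Ω(g) u ^ ∂(g)` gives an Euler product `V` satisfying `u V' = L V`, where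
`L` collects the weighted prime powers. After rescaling `u` to `u / q`, the Prime Number Theorem
says that the coefficients of `L` are exponentially close to `X`. If all of them (from degree one
on) were equal to `X`, the solution would be `(1 - u) ^ (-X)`; its coefficients `cyclePoly n` are
the laws of sums of independent Bernoulli variables with parameters `1 / (i + 1)`, `i < n`. The
quotient of the two series has coefficients of summable length (`exists_eq_sum_mul_cyclePoly`), so
the rescaled counts of `Ω` are one fixed summable convolution of the `cyclePoly (n - i)`.

Two properties of the Bernoulli sums therefore pass to `Ω` by dominated convergence: the central
limit theorem at scale `√(log n)`, and the fact that a shift by one changes the law by `o(1)` in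
total variation.

For the dynamics, shift invariance allows `f(T^Ω x)` to be replaced by its mean over `N` further
iterates, while the weight `F` hardly moves, a bounded shift being `o(√(log n))`. Unique ergodicity
makes that mean close to `∫ f dμ` uniformly in the starting point. The integral factors out, and the
remaining average of `F` is given by Erdős–Kac. -/

namespace Polynomial

/-! ### Total variation norm on generating polynomials -/

/-- The length of a real polynomial: the sum of the absolute values of its coefficients. -/
noncomputable def length (p : ℝ[X]) : ℝ := p.sum fun _ a => |a|

/-- The pairing of a real polynomial with a sequence of complex numbers. -/
noncomputable def pairing (p : ℝ[X]) (φ : ℕ → ℂ) : ℂ := p.sum fun k a => (a : ℂ) * φ k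

theorem length_eq_sum_range (p : ℝ[X]) {N : ℕ} (h : p.natDegree < N) :
    p.length = ∑ k ∈ Finset.range N, |p.coeff k| :=
  p.sum_over_range' (by simp) N h

theorem length_nonneg (p : ℝ[X]) : 0 ≤ p.length :=
  Finset.sum_nonneg fun _ _ => abs_nonneg _

@[simp]
theorem length_zero : (0 : ℝ[X]).length = 0 := by simp [length]

@[simp]
theorem length_monomial (n : ℕ) (a : ℝ) : (monomial n a).length = |a| :=
  sum_monomial_index _ _ (by simp)

@[simp]
theorem length_one : (1 : ℝ[X]).length = 1 := by
  rw [← monomial_zero_one, length_monomial, abs_one]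

@[simp]
theorem length_X : (X : ℝ[X]).length = 1 := by
  rw [← monomial_one_one_eq_X, length_monomial, abs_one]

@[simp]
theorem length_C (a : ℝ) : (C a).length = |a| := by
  rw [← monomial_zero_left, length_monomial]

@[simp]
theorem length_neg (p : ℝ[X]) : (-p).length = p.length := by
  simp [length, sum_def]

theorem length_add_le (p q : ℝ[X]) : (p + q).length ≤ p.length + q.length := by
  set N := max p.natDegree q.natDegree + 1
  have hp : p.natDegree < N := Nat.lt_succ_of_le (le_max_left _ _)
  have hq : q.natDegree < N := Nat.lt_succ_of_le (le_max_right _ _)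
  have hpq : (p + q).natDegree < N := Nat.lt_succ_of_le (natDegree_add_le p q)
  rw [length_eq_sum_range _ hp, length_eq_sum_range _ hq, length_eq_sum_range _ hpq,
    ← Finset.sum_add_distrib]
  exact Finset.sum_le_sum fun k _ => by rw [coeff_add]; exact abs_add_le _ _

theorem length_sub_le (p q : ℝ[X]) : (p - q).length ≤ p.length + q.length := by
  simpa [sub_eq_add_neg] using length_add_le p (-q)

theorem length_sum_le {ι : Type*} (s : Finset ι) (f : ι → ℝ[X]) :
    (∑ i ∈ s, f i).length ≤ ∑ i ∈ s, (f i).length :=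
  Finset.le_sum_of_subadditive _ length_zero.le length_add_le s f

theorem length_mul_le (p q : ℝ[X]) : (p * q).length ≤ p.length * q.length := by
  rw [mul_eq_sum_sum]
  refine (length_sum_le _ _).trans ?_
  rw [length, sum_def, Finset.sum_mul]
  refine Finset.sum_le_sum fun i _ => ?_
  rw [sum_def, show q.length = ∑ j ∈ q.support, |q.coeff j| from rfl, Finset.mul_sum]
  refine (length_sum_le _ _).trans (Finset.sum_le_sum fun j _ => ?_)
  rw [length_monomial, abs_mul]

theorem length_C_mul (a : ℝ) (p : ℝ[X]) : (C a * p).length = |a| * p.length := by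
  have h : (C a * p).natDegree < p.natDegree + 1 := Nat.lt_succ_of_le (natDegree_C_mul_le a p)
  rw [length_eq_sum_range _ h, length_eq_sum_range _ (Nat.lt_succ_self _), Finset.mul_sum]
  simp [abs_mul]

theorem length_eq_eval_one {p : ℝ[X]} (hp : ∀ k, 0 ≤ p.coeff k) : p.length = p.eval 1 := by
  rw [eval_eq_sum]
  simp [length, sum_def, abs_of_nonneg, hp]

theorem pairing_eq_sum_range (p : ℝ[X]) (φ : ℕ → ℂ) {N : ℕ} (h : p.natDegree < N) :
    p.pairing φ = ∑ k ∈ Finset.range N, (p.coeff k : ℂ) * φ k :=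
  p.sum_over_range' (by simp) N h

@[simp]
theorem pairing_zero (φ : ℕ → ℂ) : (0 : ℝ[X]).pairing φ = 0 := by simp [pairing]

@[simp]
theorem pairing_monomial (n : ℕ) (a : ℝ) (φ : ℕ → ℂ) :
    (monomial n a).pairing φ = a * φ n :=
  sum_monomial_index _ _ (by simp)

theorem pairing_add (p q : ℝ[X]) (φ : ℕ → ℂ) :
    (p + q).pairing φ = p.pairing φ + q.pairing φ :=
  sum_add_index _ _ _ (by simp) (by intros; push_cast; ring)

theorem pairing_sum {ι : Type*} (s : Finset ι) (f : ι → ℝ[X]) (φ : ℕ → ℂ) :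
    (∑ i ∈ s, f i).pairing φ = ∑ i ∈ s, (f i).pairing φ :=
  map_sum (⟨⟨fun p => p.pairing φ, pairing_zero φ⟩, fun p q => pairing_add p q φ⟩ :
    ℝ[X] →+ ℂ) f s

theorem pairing_sub (p q : ℝ[X]) (φ : ℕ → ℂ) :
    (p - q).pairing φ = p.pairing φ - q.pairing φ := by
  rw [eq_sub_iff_add_eq, ← pairing_add, sub_add_cancel]

theorem pairing_X_mul (p : ℝ[X]) (φ : ℕ → ℂ) :
    (X * p).pairing φ = p.pairing fun k => φ (k + 1) := by
  induction p using Polynomial.induction_on' with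
  | add p q hp hq => rw [mul_add, pairing_add, pairing_add, hp, hq]
  | monomial n a => rw [X_mul_monomial, pairing_monomial, pairing_monomial]

theorem pairing_pow (p : ℝ[X]) (z : ℂ) : (p.pairing fun k => z ^ k) = aeval z p := by
  rw [aeval_eq_sum_range, pairing_eq_sum_range _ _ (Nat.lt_succ_self _)]
  simp [Algebra.smul_def]

theorem norm_pairing_le (p : ℝ[X]) {φ : ℕ → ℂ} {M : ℝ} (hφ : ∀ k, ‖φ k‖ ≤ M) :
    ‖p.pairing φ‖ ≤ p.length * M := by
  rw [length, sum_def, Finset.sum_mul]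
  refine (norm_sum_le _ _).trans (Finset.sum_le_sum fun k _ => ?_)
  rw [norm_mul, Complex.norm_real, Real.norm_eq_abs]
  exact mul_le_mul_of_nonneg_left (hφ k) (abs_nonneg _)

theorem norm_aeval_le_length (p : ℝ[X]) {z : ℂ} (hz : ‖z‖ ≤ 1) : ‖aeval z p‖ ≤ p.length := by
  rw [← pairing_pow]
  simpa using norm_pairing_le p (M := 1) fun k => by
    rw [norm_pow]; exact pow_le_one₀ (norm_nonneg _) hz

end Polynomial

/-! ### Laws of cycle numbers: mean, variance, shift invariance -/

namespace Polynomial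

/-- Since `X * derivative` multiplies the `k`-th coefficient by `k`, the left side is a mean
absolute deviation from `h`. The pointwise bound `2|k - h| ≤ (k - h)² / s + s` then plays the role
of Cauchy–Schwarz, with `s` free to be optimized. -/
theorem length_X_mul_derivative_sub_le {p : ℝ[X]} (hp : ∀ k, 0 ≤ p.coeff k) (h : ℝ) {s : ℝ}
    (hs : 0 < s) :
    (X * derivative p - C h * p).length ≤
      ((X * derivative (X * derivative p) - C (2 * h) * (X * derivative p) +
        C (h ^ 2) * p).eval 1 / s + s * p.eval 1) / 2 := by
  have hc : ∀ (p : ℝ[X]) (k : ℕ), (X * derivative p).coeff k = k * p.coeff k := by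
    rintro p (_ | k)
    · simp
    · rw [coeff_X_mul, coeff_derivative]; push_cast; ring
  set Q := X * derivative (X * derivative p) - C (2 * h) * (X * derivative p) + C (h ^ 2) * p
    with hQ
  have hQc : ∀ k, Q.coeff k = p.coeff k * ((k : ℝ) - h) ^ 2 := by
    intro k
    rw [hQ, coeff_add, coeff_sub, coeff_C_mul, coeff_C_mul, hc, hc]
    ring
  set N := max (max Q.natDegree p.natDegree) (X * derivative p - C h * p).natDegree + 1
  have h1 : Q.natDegree < N := by omega
  have h2 : p.natDegree < N := by omega
  have h3 : (X * derivative p - C h * p).natDegree < N := by omega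
  rw [eval_eq_sum_range' h1, eval_eq_sum_range' h2, length_eq_sum_range _ h3, Finset.sum_div,
    Finset.mul_sum, ← Finset.sum_add_distrib, Finset.sum_div]
  refine Finset.sum_le_sum fun k _ => ?_
  rw [hQc, coeff_sub, coeff_C_mul, hc, ← sub_mul, abs_mul, abs_of_nonneg (hp k)]
  have key : |(k : ℝ) - h| ≤ (((k : ℝ) - h) ^ 2 / s + s) / 2 := by
    rw [← sq_abs]
    have : |(k : ℝ) - h| ^ 2 / s + s - 2 * |(k : ℝ) - h| = (|(k : ℝ) - h| - s) ^ 2 / s := by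
      field_simp; ring
    have h0 : 0 ≤ (|(k : ℝ) - h| - s) ^ 2 / s := by positivity
    linarith
  calc |(k : ℝ) - h| * p.coeff k ≤ (((k : ℝ) - h) ^ 2 / s + s) / 2 * p.coeff k :=
        mul_le_mul_of_nonneg_right key (hp k)
    _ = _ := by simp only [one_pow]; ring

/-- The sum of `1 / (i + 1)` over `i < n`. -/
noncomputable def harmonicSum (n : ℕ) : ℝ := ∑ i ∈ Finset.range n, 1 / ((i : ℝ) + 1)

theorem harmonicSum_succ (n : ℕ) : harmonicSum (n + 1) = harmonicSum n + 1 / ((n : ℝ) + 1) :=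
  Finset.sum_range_succ _ _

/-- The generating polynomial of the number of cycles of a uniformly random permutation of `n`
letters. -/
noncomputable def cyclePoly (n : ℕ) : ℝ[X] :=
  ∏ i ∈ Finset.range n, (1 + C (1 / ((i : ℝ) + 1)) * (X - 1))

theorem cyclePoly_succ (n : ℕ) :
    cyclePoly (n + 1) = cyclePoly n * (1 + C (1 / ((n : ℝ) + 1)) * (X - 1)) :=
  Finset.prod_range_succ _ _

@[simp]
theorem cyclePoly_zero : cyclePoly 0 = 1 := Finset.prod_range_zero _

theorem bernoulliPoly_eq (a : ℝ) : 1 + C a * (X - 1) = C (1 - a) + C a * X := by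
  rw [C_sub, C_1]; ring

theorem length_bernoulliPoly_le {a : ℝ} (h0 : 0 ≤ a) (h1 : a ≤ 1) :
    (1 + C a * (X - 1)).length ≤ 1 := by
  rw [bernoulliPoly_eq]
  refine (length_add_le _ _).trans ?_
  rw [length_C_mul, length_C, length_X, abs_of_nonneg h0, abs_of_nonneg (by linarith)]
  linarith

theorem one_div_succ_le_one (n : ℕ) : 1 / ((n : ℝ) + 1) ≤ 1 := by
  rw [div_le_one (by positivity)]; linarith [n.cast_nonneg (α := ℝ)]

theorem coeff_cyclePoly_nonneg (n k : ℕ) : 0 ≤ (cyclePoly n).coeff k := by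
  induction n generalizing k with
  | zero => rw [cyclePoly_zero, coeff_one]; split_ifs <;> norm_num
  | succ n ih =>
    have h1 := one_div_succ_le_one n
    have h0 : 0 ≤ 1 / ((n : ℝ) + 1) := by positivity
    rw [cyclePoly_succ, bernoulliPoly_eq, mul_comm, add_mul, coeff_add, coeff_C_mul, mul_assoc,
      coeff_C_mul]
    refine add_nonneg (mul_nonneg (by linarith) (ih k)) (mul_nonneg h0 ?_)
    cases k with
    | zero => simp
    | succ k => rw [coeff_X_mul]; exact ih k

@[simp]
theorem eval_one_cyclePoly (n : ℕ) : (cyclePoly n).eval 1 = 1 := by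
  simp [cyclePoly, eval_prod]

@[simp]
theorem length_cyclePoly (n : ℕ) : (cyclePoly n).length = 1 := by
  rw [length_eq_eval_one (coeff_cyclePoly_nonneg n), eval_one_cyclePoly]

theorem eval_one_derivative_cyclePoly (n : ℕ) :
    (derivative (cyclePoly n)).eval 1 = harmonicSum n := by
  induction n with
  | zero => simp [harmonicSum]
  | succ n ih => simp [cyclePoly_succ, harmonicSum_succ, ih]

/-- Variances of independent Bernoulli variables add, and each `a (1 - a)` is at most the mean `a`.
-/
theorem variance_cyclePoly_le (n : ℕ) :
    (derivative (derivative (cyclePoly n))).eval 1 + harmonicSum n - harmonicSum n ^ 2 ≤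
      harmonicSum n := by
  induction n with
  | zero => simp [harmonicSum]
  | succ n ih =>
    simp only [cyclePoly_succ, derivative_mul, derivative_add, derivative_sub, derivative_one,
      derivative_C, derivative_X, eval_add, eval_mul, eval_sub, eval_one, eval_C, eval_X,
      eval_one_derivative_cyclePoly, eval_one_cyclePoly, harmonicSum_succ, eval_zero,
      derivative_zero]
    have h0 : 0 ≤ 1 / ((n : ℝ) + 1) := by positivity
    nlinarith [sq_nonneg (1 / ((n : ℝ) + 1))]

/-- A Poisson law of mean `H` satisfies `D' = H D` exactly. Each new Bernoulli factor of parameter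
`a` adds only the defect `a² (X - 1) D`, of length at most `2 a²`, and `∑ 1 / (i + 1)²` converges.
-/
theorem exists_length_derivative_cyclePoly_sub_le :
    ∃ K : ℝ, ∀ n, (derivative (cyclePoly n) - C (harmonicSum n) * cyclePoly n).length ≤ K := by
  have hs : Summable fun i : ℕ => 2 * (1 / ((i : ℝ) + 1)) ^ 2 := by
    have h := (summable_nat_add_iff 1).2 (Real.summable_one_div_nat_pow.2 one_lt_two)
    refine (h.mul_left 2).congr fun i => ?_
    push_cast; rw [one_div_pow]
  refine ⟨∑' i : ℕ, 2 * (1 / ((i : ℝ) + 1)) ^ 2, fun n => ?_⟩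
  refine le_trans ?_ (hs.sum_le_tsum (Finset.range n) fun i _ => by positivity)
  induction n with
  | zero => simp [harmonicSum]
  | succ n ih =>
    have h1 := one_div_succ_le_one n
    have h0 : 0 ≤ 1 / ((n : ℝ) + 1) := by positivity
    rw [Finset.sum_range_succ, cyclePoly_succ, harmonicSum_succ]
    set a := 1 / ((n : ℝ) + 1)
    set D := cyclePoly n
    have e : derivative (D * (1 + C a * (X - 1))) -
        C (harmonicSum n + a) * (D * (1 + C a * (X - 1))) =
        (derivative D - C (harmonicSum n) * D) * (1 + C a * (X - 1)) -
          C (a ^ 2) * ((X - 1) * D) := by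
      simp only [derivative_mul, derivative_add, derivative_sub, derivative_one, derivative_C,
        derivative_X, C_add, C_pow]
      ring
    rw [e]
    refine (length_sub_le _ _).trans (add_le_add ?_ ?_)
    · refine (length_mul_le _ _).trans (le_trans ?_ ih)
      exact mul_le_of_le_one_right (length_nonneg _) (length_bernoulliPoly_le h0 h1)
    · rw [length_C_mul, abs_of_nonneg (by positivity), mul_comm]
      refine mul_le_mul_of_nonneg_right ((length_mul_le _ _).trans ?_) (by positivity)
      rw [length_cyclePoly, mul_one]
      refine (length_sub_le _ _).trans ?_
      rw [length_X, length_one]; norm_num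

theorem tendsto_harmonicSum : Tendsto harmonicSum atTop atTop := by
  have := Real.tendsto_sum_range_one_div_nat_succ_atTop
  exact this

/-- The laws of the cycle numbers are asymptotically shift invariant in total variation. -/
theorem tendsto_length_X_sub_one_mul_cyclePoly :
    Tendsto (fun n => ((X - 1) * cyclePoly n).length) atTop (𝓝 0) := by
  obtain ⟨K, hK⟩ := exists_length_derivative_cyclePoly_sub_le
  have hsq : Tendsto (fun n => √(harmonicSum n)) atTop atTop :=
    Real.tendsto_sqrt_atTop.comp tendsto_harmonicSum
  have hlim : Tendsto (fun n => K / harmonicSum n + 1 / √(harmonicSum n)) atTop (𝓝 0) := by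
    simpa using (tendsto_harmonicSum.const_div_atTop K).add (hsq.const_div_atTop 1)
  refine squeeze_zero' (Eventually.of_forall fun n => length_nonneg _) ?_ hlim
  filter_upwards [tendsto_harmonicSum.eventually_gt_atTop 0] with n hn
  set H := harmonicSum n
  set D := cyclePoly n
  have hs : 0 < √H := Real.sqrt_pos.2 hn
  -- The first summand is the bounded Poisson defect, the second a mean absolute deviation of size
  -- at most `√H`. Dividing by `H` gives decay.
  have e : C H * ((X - 1) * D) = X * (C H * D - derivative D) + (X * derivative D - C H * D) := by
    ring
  have h1 : H * ((X - 1) * D).length ≤ K + √H := by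
    rw [← abs_of_pos hn, ← length_C_mul, e, abs_of_pos hn]
    refine (length_add_le _ _).trans (add_le_add ?_ ?_)
    · refine (length_mul_le _ _).trans ?_
      rw [length_X, one_mul, ← length_neg, neg_sub]
      exact hK n
    · refine (length_X_mul_derivative_sub_le (coeff_cyclePoly_nonneg n) H hs).trans ?_
      have hv := variance_cyclePoly_le n
      have : (X * derivative (X * derivative (cyclePoly n)) -
          C (2 * H) * (X * derivative (cyclePoly n)) + C (H ^ 2) * cyclePoly n).eval 1 ≤ H := by
        simp only [derivative_mul, derivative_X, eval_add, eval_mul, eval_sub, eval_one, eval_C,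
          eval_X, eval_one_derivative_cyclePoly, eval_one_cyclePoly]
        linarith
      rw [eval_one_cyclePoly]
      have h2 : H / √H = √H := Real.div_sqrt
      have := div_le_div_of_nonneg_right this hs.le
      rw [h2] at this
      linarith
  have h3 : 1 / √H = √H / H := by
    rw [div_eq_div_iff hs.ne' hn.ne', one_mul, Real.mul_self_sqrt hn.le]
  rw [h3, ← add_div, le_div_iff₀ hn, mul_comm]
  exact h1

end Polynomial

/-! ### Perturbing the logarithmic derivative of a generating series -/

/-- Tannery's theorem for the triangular sums `∑ i ≤ n, f n i`. -/
theorem tendsto_sum_range_succ_of_dominated {E : Type*} [NormedAddCommGroup E] [CompleteSpace E]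
    {f : ℕ → ℕ → E} {g : ℕ → E} {bound : ℕ → ℝ} (hb : Summable bound)
    (hf : ∀ i, Tendsto (fun n => f n i) atTop (𝓝 (g i)))
    (hbound : ∀ n i, i ≤ n → ‖f n i‖ ≤ bound i) :
    Tendsto (fun n => ∑ i ∈ Finset.range (n + 1), f n i) atTop (𝓝 (∑' i, g i)) := by
  have h0 : ∀ i, 0 ≤ bound i := fun i => (norm_nonneg _).trans (hbound i i le_rfl)
  have key := tendsto_tsum_of_dominated_convergence (𝓕 := atTop)
    (f := fun n i => if i ∈ Finset.range (n + 1) then f n i else 0) (g := g) hb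
    (fun i => (hf i).congr' ?_) (Eventually.of_forall fun n i => ?_)
  · refine key.congr fun n => ?_
    rw [tsum_eq_sum (s := Finset.range (n + 1)) fun i hi => if_neg hi]
    exact Finset.sum_congr rfl fun i hi => if_pos hi
  · filter_upwards [eventually_ge_atTop i] with n hn
    rw [if_pos (Finset.mem_range.2 (Nat.lt_succ_of_le hn))]
  · split_ifs with hi
    · exact hbound n i (Nat.le_of_lt_succ (Finset.mem_range.1 hi))
    · rw [norm_zero]; exact h0 i

/-- The factor `n` on the left eventually beats the constant. With `ρ < s < 1` and the hypothesis `a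
k ≤ M s ^ k` for `k < n`, the right side is at most `M s ^ n` times `C / (1 - ρ / s)`, which is at
most `n` beyond `N`; `M` absorbs the indices up to `N`. -/
theorem summable_of_mul_le_sum_pow {a : ℕ → ℝ} (ha : ∀ n, 0 ≤ a n) {C ρ : ℝ} (hC : 0 ≤ C)
    (hρ0 : 0 < ρ) (hρ1 : ρ < 1)
    (h : ∀ n : ℕ, n * a n ≤ ∑ k ∈ Finset.range n, C * ρ ^ (n - k) * a k) : Summable a := by
  obtain ⟨s, hρs, hs1⟩ := exists_between hρ1
  have hs0 : 0 < s := hρ0.trans hρs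
  set t := ρ / s with ht
  have ht0 : 0 < t := div_pos hρ0 hs0
  have ht1 : t < 1 := (div_lt_one hs0).2 hρs
  obtain ⟨N, hN⟩ := exists_nat_ge (C * (1 - t)⁻¹)
  set M := ∑ k ∈ Finset.range (N + 1), a k / s ^ k with hM
  have hM0 : 0 ≤ M := Finset.sum_nonneg fun k _ => div_nonneg (ha k) (pow_nonneg hs0.le k)
  have hbound : ∀ n, a n ≤ M * s ^ n := by
    intro n
    induction n using Nat.strong_induction_on with
    | _ n ih =>
    rcases le_or_gt n N with hn | hn
    · rw [← div_le_iff₀ (pow_pos hs0 n)]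
      exact Finset.single_le_sum (f := fun k => a k / s ^ k)
        (fun k _ => div_nonneg (ha k) (pow_nonneg hs0.le k))
        (Finset.mem_range.2 (Nat.lt_succ_of_le hn))
    · have hn0 : (0 : ℝ) < n := by exact_mod_cast (Nat.zero_le N).trans_lt hn
      have hgeom : ∑ k ∈ Finset.range n, t ^ (n - k) ≤ (1 - t)⁻¹ := by
        rw [← tsum_geometric_of_lt_one ht0.le ht1,
          ← Finset.sum_range_reflect (fun k => t ^ (n - k)) n]
        calc ∑ j ∈ Finset.range n, t ^ (n - (n - 1 - j))
            ≤ ∑ j ∈ Finset.range n, t ^ j := Finset.sum_le_sum fun j hj =>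
              pow_le_pow_of_le_one ht0.le ht1.le (by have := Finset.mem_range.1 hj; omega)
          _ ≤ _ := (summable_geometric_of_lt_one ht0.le ht1).sum_le_tsum _
              fun i _ => pow_nonneg ht0.le i
      refine le_of_mul_le_mul_left ?_ hn0
      calc n * a n ≤ ∑ k ∈ Finset.range n, C * ρ ^ (n - k) * a k := h n
        _ ≤ ∑ k ∈ Finset.range n, C * M * s ^ n * t ^ (n - k) := by
            refine Finset.sum_le_sum fun k hk => ?_
            have hk := Finset.mem_range.1 hk
            have e : s ^ n = s ^ (n - k) * s ^ k := by rw [← pow_add]; congr 1; omega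
            calc C * ρ ^ (n - k) * a k ≤ C * ρ ^ (n - k) * (M * s ^ k) :=
                  mul_le_mul_of_nonneg_left (ih k hk) (by positivity)
              _ = _ := by rw [ht, div_pow, e]; field_simp
        _ = M * s ^ n * (C * ∑ k ∈ Finset.range n, t ^ (n - k)) := by
            rw [← Finset.mul_sum]; ring
        _ ≤ M * s ^ n * n := by
            refine mul_le_mul_of_nonneg_left ?_ (by positivity)
            refine (mul_le_mul_of_nonneg_left hgeom hC).trans (hN.trans ?_)
            exact_mod_cast hn.le
        _ = n * (M * s ^ n) := by ring
  exact Summable.of_nonneg_of_le ha hbound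
    ((summable_geometric_of_lt_one hs0.le hs1).mul_left M)

namespace Polynomial
open Finset

/-- Coefficient form of the equation `u D' = (X u / (1 - u)) D` for `D = (1 - u) ^ (-X)`. -/
theorem cyclePoly_recursion (n : ℕ) :
    (n : ℝ[X]) * cyclePoly n = ∑ j ∈ range n, X * cyclePoly j := by
  induction n with
  | zero => simp
  | succ n ih =>
    rw [sum_range_succ, ← ih, cyclePoly_succ]
    have h : ((n : ℝ[X]) + 1) * C (1 / ((n : ℝ) + 1)) = 1 := by
      rw [← C_eq_natCast, ← C_1, ← C_add, ← C_mul]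
      congr 1
      field_simp
    push_cast
    linear_combination (X - 1) * cyclePoly n * h

theorem coeff_X_mul_derivative {R : Type*} [CommRing R] (f : PowerSeries R) (n : ℕ) :
    PowerSeries.coeff n (PowerSeries.X * PowerSeries.derivative R f) =
      n * PowerSeries.coeff n f := by
  cases n with
  | zero => simp
  | succ n => rw [PowerSeries.coeff_succ_X_mul, PowerSeries.coeff_derivative]; push_cast; ring

theorem derivative_powerSeries_mul {R : Type*} [CommRing R] (f g : PowerSeries R) :
    PowerSeries.derivative R (f * g) =
      f * PowerSeries.derivative R g + g * PowerSeries.derivative R f := by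
  rw [Derivation.leibniz, smul_eq_mul, smul_eq_mul]

/-- If the logarithmic derivative of the generating series of `v` is close to that of the
generating series of the cycle polynomials, then `v` is the convolution of the cycle polynomials
with a sequence of summable length. -/
theorem exists_eq_sum_mul_cyclePoly {v lam : ℕ → ℝ[X]} (hlam0 : lam 0 = 0)
    (hv : ∀ n : ℕ, (n : ℝ[X]) * v n = ∑ x ∈ antidiagonal n, lam x.1 * v x.2)
    {C ρ : ℝ} (hC : 0 ≤ C) (hρ0 : 0 < ρ) (hρ1 : ρ < 1)
    (hlam : ∀ m, m ≠ 0 → (lam m - X).length ≤ C * ρ ^ m) :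
    ∃ h : ℕ → ℝ[X], (Summable fun n => (h n).length) ∧
      ∀ n, v n = ∑ x ∈ antidiagonal n, h x.1 * cyclePoly x.2 := by
  set V := PowerSeries.mk v with hV
  set D := PowerSeries.mk cyclePoly with hD
  set L := PowerSeries.mk lam with hL
  set E : PowerSeries ℝ[X] := PowerSeries.mk fun n => if n = 0 then 0 else X with hE
  have hVL : PowerSeries.X * PowerSeries.derivative _ V = L * V := by
    ext1 n
    rw [coeff_X_mul_derivative, PowerSeries.coeff_mul]
    simpa [hV, hL] using hv n
  have hDE : PowerSeries.X * PowerSeries.derivative _ D = E * D := by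
    ext1 n
    rw [coeff_X_mul_derivative, mul_comm E D, PowerSeries.coeff_mul,
      Nat.sum_antidiagonal_eq_sum_range_succ_mk, sum_range_succ]
    simp only [hD, hE, PowerSeries.coeff_mk, cyclePoly_recursion]
    simp only [Nat.sub_self, if_true, mul_zero, add_zero]
    refine sum_congr rfl fun j hj => ?_
    have := mem_range.1 hj
    rw [if_neg (by omega), mul_comm]
  obtain ⟨W, hW⟩ : ∃ W, D * W = 1 := by
    have : IsUnit D := PowerSeries.isUnit_iff_constantCoeff.2 (by simp [hD])
    exact this.exists_right_inv
  obtain ⟨H, hH⟩ : ∃ H, H = V * W := ⟨_, rfl⟩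
  have hVD : V = H * D := by rw [hH, mul_assoc, mul_comm W, hW, mul_one]
  -- Logarithmic derivatives subtract under division, so `H = V / D` solves the same kind of
  -- equation with the small coefficients of `L - E`.
  have hHE : PowerSeries.X * PowerSeries.derivative _ H = (L - E) * H := by
    have h1 := hVL
    rw [hVD, derivative_powerSeries_mul] at h1
    linear_combination W * h1 - W * H * hDE -
      (PowerSeries.X * PowerSeries.derivative _ H - (L - E) * H) * hW
  refine ⟨fun n => PowerSeries.coeff n H, ?_, fun n => ?_⟩
  · refine summable_of_mul_le_sum_pow (fun n => length_nonneg _) hC hρ0 hρ1 fun n => ?_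
    have h1 := congrArg (PowerSeries.coeff n) hHE
    rw [coeff_X_mul_derivative, mul_comm (L - E), PowerSeries.coeff_mul,
      Nat.sum_antidiagonal_eq_sum_range_succ_mk, sum_range_succ] at h1
    -- The diagonal term vanishes because `L` and `E` have no constant term; only indices below `n`
    -- remain, as the summability lemma requires.
    have h2 : PowerSeries.coeff (n - n) (L - E) = 0 := by simp [hL, hE, hlam0]
    rw [h2, mul_zero, add_zero] at h1
    have h3 : (n : ℝ) * (PowerSeries.coeff n H).length =
        ((n : ℝ[X]) * PowerSeries.coeff n H).length := by
      rw [← C_eq_natCast, length_C_mul, abs_of_nonneg n.cast_nonneg]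
    rw [h3, h1]
    refine (length_sum_le _ _).trans (sum_le_sum fun k hk => (length_mul_le _ _).trans ?_)
    rw [mul_comm]
    refine mul_le_mul_of_nonneg_right ?_ (length_nonneg _)
    have hk := mem_range.1 hk
    have hne : n - k ≠ 0 := by omega
    simpa [hL, hE, hne] using hlam (n - k) hne
  · have := congrArg (PowerSeries.coeff n) hVD
    rw [PowerSeries.coeff_mul] at this
    simpa [hV, hD] using this

end Polynomial

/-! ### Prime factorization and the recursion for `Ω` -/

namespace AdditiveArithmeticalSemigroup
open Polynomial Finset

variable {G : Type*} [CommMonoid G] (S : AdditiveArithmeticalSemigroup G)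

theorem mem_primes_of_mem_primeFactors {g p : G} (h : p ∈ S.primeFactors g) : p ∈ S.primes :=
  (S.unique_factorization g).choose_spec.1.1 p h

theorem prod_primeFactors (g : G) : (S.primeFactors g).prod = g :=
  (S.unique_factorization g).choose_spec.1.2

theorem primeFactors_prod {s : Multiset G} (hs : ∀ p ∈ s, p ∈ S.primes) :
    S.primeFactors s.prod = s :=
  ((S.unique_factorization s.prod).choose_spec.2 s ⟨hs, rfl⟩).symm

theorem primeFactors_injective : Function.Injective S.primeFactors := fun g h e => by
  rw [← S.prod_primeFactors g, e, S.prod_primeFactors]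

theorem primeFactors_mul (g h : G) :
    S.primeFactors (g * h) = S.primeFactors g + S.primeFactors h := by
  rw [← S.primeFactors_prod (s := S.primeFactors g + S.primeFactors h), Multiset.prod_add,
    S.prod_primeFactors, S.prod_primeFactors]
  intro p hp
  rcases Multiset.mem_add.1 hp with hp | hp <;> exact S.mem_primes_of_mem_primeFactors hp

theorem primeFactors_prime_pow {p : G} (hp : p ∈ S.primes) (r : ℕ) :
    S.primeFactors (p ^ r) = Multiset.replicate r p := by
  rw [← Multiset.prod_replicate, S.primeFactors_prod]
  intro x hx
  rwa [Multiset.eq_of_mem_replicate hx]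

theorem bigOmega_mul (g h : G) : S.bigOmega (g * h) = S.bigOmega g + S.bigOmega h := by
  rw [bigOmega, primeFactors_mul, Multiset.card_add]; rfl

theorem bigOmega_prime_pow {p : G} (hp : p ∈ S.primes) (r : ℕ) : S.bigOmega (p ^ r) = r := by
  rw [bigOmega, S.primeFactors_prime_pow hp, Multiset.card_replicate]

theorem degree_eq_sum_map (g : G) : S.degree g = ((S.primeFactors g).map S.degree).sum := by
  have h : ∀ s : Multiset G, S.degree s.prod = (s.map S.degree).sum := by
    intro s
    induction s using Multiset.induction_on with
    | empty => simpa using S.degree_one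
    | cons a s ih => rw [Multiset.prod_cons, S.degree_mul, ih, Multiset.map_cons, Multiset.sum_cons]
  conv_lhs => rw [← S.prod_primeFactors g, h]

theorem mul_left_cancel' (S : AdditiveArithmeticalSemigroup G) {a b c : G} (h : a * b = a * c) : b = c := by
  apply S.primeFactors_injective
  have := congrArg S.primeFactors h
  rwa [primeFactors_mul, primeFactors_mul, add_right_inj] at this

theorem mem_degreeLE {n : ℕ} {g : G} : g ∈ S.degreeLE n ↔ S.degree g ≤ n := by
  simp [degreeLE]

theorem finite_degree_eq (n : ℕ) : {g : G | S.degree g = n}.Finite :=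
  (S.finite_degree_le n).subset fun _ h => le_of_eq h

/-- The finite set of elements of degree `n`. -/
noncomputable def degreeEq (n : ℕ) : Finset G := (S.finite_degree_eq n).toFinset

theorem mem_degreeEq {n : ℕ} {g : G} : g ∈ S.degreeEq n ↔ S.degree g = n := by
  simp [degreeEq]

theorem card_degreeEq (n : ℕ) : (S.degreeEq n).card = S.count n :=
  (Set.ncard_eq_toFinset_card _ (S.finite_degree_eq n)).symm

/-- The pairs `(p, r)` with `p` prime, `r ≥ 1` and `∂(p ^ r) = n`. -/
noncomputable def primePowers (n : ℕ) : Finset (G × ℕ) := (S.finite_primePowers n).toFinset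

theorem mem_primePowers {n : ℕ} {x : G × ℕ} :
    x ∈ S.primePowers n ↔ x.1 ∈ S.primes ∧ 1 ≤ x.2 ∧ S.degree (x.1 ^ x.2) = n := by
  simp [primePowers]

/-- The generating polynomial of `Ω` on the elements of degree `n`. -/
noncomputable def omegaPoly (n : ℕ) : ℝ[X] := ∑ g ∈ S.degreeEq n, X ^ S.bigOmega g

/-- The weighted generating polynomial of the exponents of the prime powers of degree `n`. -/
noncomputable def lambdaPoly (n : ℕ) : ℝ[X] :=
  ∑ x ∈ S.primePowers n, (S.degree x.1 : ℝ[X]) * X ^ x.2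

open Classical in
/-- The pairs `(p, r)` with `p` prime, `r ≥ 1` and `p ^ r` dividing `g`. -/
noncomputable def primePowerDivisors (g : G) : Finset (G × ℕ) :=
  (S.primeFactors g).toFinset.biUnion fun p =>
    (Icc 1 ((S.primeFactors g).count p)).image fun r => (p, r)

open Classical in
theorem mem_primePowerDivisors {g : G} {x : G × ℕ} :
    x ∈ S.primePowerDivisors g ↔ 1 ≤ x.2 ∧ x.2 ≤ (S.primeFactors g).count x.1 := by
  simp only [primePowerDivisors, mem_biUnion, mem_image, mem_Icc, Multiset.mem_toFinset]
  constructor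
  · rintro ⟨p, -, r, h, rfl⟩
    exact h
  · intro h
    exact ⟨x.1, Multiset.count_pos.1 (by omega), x.2, h, rfl⟩

theorem degree_eq_sum_primePowerDivisors (g : G) :
    S.degree g = ∑ x ∈ S.primePowerDivisors g, S.degree x.1 := by
  classical
  rw [degree_eq_sum_map, Finset.sum_multiset_map_count, primePowerDivisors, sum_biUnion]
  · refine sum_congr rfl fun p _ => ?_
    rw [sum_image (fun a _ b _ h => (Prod.ext_iff.1 h).2)]
    simp
  · intro p _ p' _ hne
    refine disjoint_left.2 fun x hx hx' => hne ?_
    obtain ⟨r, -, rfl⟩ := mem_image.1 hx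
    obtain ⟨r', -, h⟩ := mem_image.1 hx'
    exact (Prod.ext_iff.1 h).1.symm

/-- This is the logarithmic derivative of the Euler product, proved by double counting. Each `∂(g)`
is the sum of `∂(p)` over the prime powers `p ^ r` dividing `g`, and a pair consisting of `g` and
such a divisor is the same as a factorization `g = p ^ r g'`, for which `Ω(g) = r + Ω(g')`. -/
theorem omegaPoly_recursion (n : ℕ) :
    (n : ℝ[X]) * S.omegaPoly n =
      ∑ x ∈ antidiagonal n, S.lambdaPoly x.1 * S.omegaPoly x.2 := by
  classical
  have hl : (n : ℝ[X]) * S.omegaPoly n = ∑ y ∈ (S.degreeEq n).sigma fun g => S.primePowerDivisors g,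
      (S.degree y.2.1 : ℝ[X]) * X ^ S.bigOmega y.1 := by
    rw [omegaPoly, mul_sum, sum_sigma]
    refine sum_congr rfl fun g hg => ?_
    simp only []
    rw [← sum_mul, ← S.mem_degreeEq.1 hg, S.degree_eq_sum_primePowerDivisors g, Nat.cast_sum]
  have hr : ∑ x ∈ antidiagonal n, S.lambdaPoly x.1 * S.omegaPoly x.2 =
      ∑ y ∈ (antidiagonal n).sigma fun x => S.primePowers x.1 ×ˢ S.degreeEq x.2,
        (S.degree y.2.1.1 : ℝ[X]) * X ^ y.2.1.2 * X ^ S.bigOmega y.2.2 := by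
    rw [sum_sigma]
    refine sum_congr rfl fun x _ => ?_
    rw [lambdaPoly, omegaPoly, sum_mul_sum, sum_product]
  rw [hl, hr]
  symm
  refine sum_bij (fun y _ => ⟨y.2.1.1 ^ y.2.1.2 * y.2.2, y.2.1⟩) ?_ ?_ ?_ ?_
  · rintro ⟨⟨i, j⟩, ⟨p, r⟩, g⟩ h
    simp only [mem_sigma, HasAntidiagonal.mem_antidiagonal, mem_product, mem_primePowers, mem_degreeEq] at h
    obtain ⟨hij, ⟨hp, hr, hd⟩, hg⟩ := h
    simp only [mem_sigma, mem_degreeEq, mem_primePowerDivisors]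
    refine ⟨by rw [S.degree_mul, hd, hg, hij], hr, ?_⟩
    rw [primeFactors_mul, S.primeFactors_prime_pow hp, Multiset.count_add,
      Multiset.count_replicate_self]
    exact Nat.le_add_right _ _
  · rintro ⟨⟨i, j⟩, ⟨p, r⟩, g⟩ h ⟨⟨i', j'⟩, ⟨p', r'⟩, g'⟩ h' e
    simp only [mem_sigma, HasAntidiagonal.mem_antidiagonal, mem_product, mem_primePowers, mem_degreeEq] at h h'
    obtain ⟨hij, ⟨hp, hr, hd⟩, hg⟩ := h
    obtain ⟨hij', ⟨hp', hr', hd'⟩, hg'⟩ := h'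
    simp only [Sigma.mk.injEq, heq_eq_eq, Prod.mk.injEq] at e
    obtain ⟨e1, rfl, rfl⟩ := e
    obtain rfl := S.mul_left_cancel' e1
    subst hd hg hd' hg'
    rfl
  · rintro ⟨g, ⟨p, r⟩⟩ h
    simp only [mem_sigma, mem_degreeEq, mem_primePowerDivisors] at h
    obtain ⟨hg, hr, hrc⟩ := h
    have hle : Multiset.replicate r p ≤ S.primeFactors g := Multiset.le_count_iff_replicate_le.1 hrc
    have hp : p ∈ S.primes := S.mem_primes_of_mem_primeFactors (Multiset.count_pos.1 (lt_of_lt_of_le hr hrc))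
    have hgg : p ^ r * (S.primeFactors g - Multiset.replicate r p).prod = g := by
      rw [← Multiset.prod_replicate, ← Multiset.prod_add, add_tsub_cancel_of_le hle,
        S.prod_primeFactors]
    refine ⟨⟨(S.degree (p ^ r), S.degree (S.primeFactors g - Multiset.replicate r p).prod),
      (p, r), (S.primeFactors g - Multiset.replicate r p).prod⟩, ?_, ?_⟩
    · simp only [mem_sigma, HasAntidiagonal.mem_antidiagonal, mem_product, mem_primePowers, mem_degreeEq]
      exact ⟨by rw [← S.degree_mul, hgg, hg], ⟨hp, hr, trivial⟩, trivial⟩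
    · simp only [hgg]
  · rintro ⟨⟨i, j⟩, ⟨p, r⟩, g⟩ h
    simp only [mem_sigma, HasAntidiagonal.mem_antidiagonal, mem_product, mem_primePowers, mem_degreeEq] at h
    simp only
    rw [S.bigOmega_mul, S.bigOmega_prime_pow h.2.1.1, pow_add, mul_assoc]

theorem lambdaPoly_zero : S.lambdaPoly 0 = 0 := by
  refine sum_eq_zero fun x hx => ?_
  obtain ⟨hp, hr, hd⟩ := S.mem_primePowers.1 hx
  have := S.degree_prime_pos _ hp
  rw [S.degree_pow] at hd
  rcases Nat.mul_eq_zero.1 hd with h | h <;> omega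

/-- The contribution of the proper prime powers to the Chebyshev function is at most the sum of
the Chebyshev function up to `n / 2`. -/
theorem sum_properPrimePowers_le (n : ℕ) :
    ∑ x ∈ S.primePowers n with 2 ≤ x.2, S.degree x.1 ≤
      ∑ d ∈ range (n / 2 + 1), S.chebyshev d := by
  classical
  have h : ∑ d ∈ range (n / 2 + 1), S.chebyshev d =
      ∑ y ∈ (range (n / 2 + 1)).sigma fun d => S.primePowers d, S.degree y.2.1 := by
    rw [sum_sigma]; rfl
  rw [h]
  -- Each `(p, r)` is sent to the prime `p` itself, of degree at most `n / 2` as `r ≥ 2`. The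
  -- exponent is recovered from `r ∂(p) = n`.
  set i : G × ℕ → (Σ _ : ℕ, G × ℕ) := fun x => ⟨S.degree x.1, (x.1, 1)⟩
  have hinj : Set.InjOn i ((S.primePowers n).filter fun x => 2 ≤ x.2 : Finset (G × ℕ)) := by
    rintro ⟨p, r⟩ hx ⟨p', r'⟩ hx' e
    simp only [coe_filter, Set.mem_ofPred_eq, mem_primePowers, S.degree_pow] at hx hx'
    simp only [i, Sigma.mk.injEq, heq_eq_eq, Prod.mk.injEq] at e
    obtain ⟨-, rfl, -⟩ := e
    have hd := S.degree_prime_pos _ hx.1.1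
    have := Nat.eq_of_mul_eq_mul_right hd (hx.1.2.2.trans hx'.1.2.2.symm)
    rw [this]
  rw [← sum_image (f := fun y : (Σ _ : ℕ, G × ℕ) => S.degree y.2.1) hinj]
  refine sum_le_sum_of_subset fun y hy => ?_
  obtain ⟨⟨p, r⟩, hx, rfl⟩ := mem_image.1 hy
  simp only [mem_filter, mem_primePowers, S.degree_pow] at hx
  simp only [i, mem_sigma, mem_range, mem_primePowers, pow_one, le_refl, and_self, and_true]
  refine ⟨?_, hx.1.1⟩
  rw [Nat.lt_succ_iff, Nat.le_div_iff_mul_le two_pos]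
  nlinarith [hx.1.2.2, hx.2]

/-- The proper prime powers count twice: once as the terms of exponent at least two, and once
because the coefficient of `X` is the Chebyshev function with their contribution removed. -/
theorem length_lambdaPoly_sub_le (n : ℕ) (a : ℝ) :
    (S.lambdaPoly n - C a * X).length ≤
      |(S.chebyshev n : ℝ) - a| + 2 * ∑ d ∈ range (n / 2 + 1), (S.chebyshev d : ℝ) := by
  set R := ∑ x ∈ S.primePowers n with 2 ≤ x.2, S.degree x.1 with hR
  set P := ∑ x ∈ S.primePowers n with ¬ 2 ≤ x.2, S.degree x.1 with hP
  have hRP : R + P = S.chebyshev n := sum_filter_add_sum_filter_not _ _ _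
  have hRle : (R : ℝ) ≤ ∑ d ∈ range (n / 2 + 1), (S.chebyshev d : ℝ) := by
    exact_mod_cast S.sum_properPrimePowers_le n
  have hsplit : S.lambdaPoly n - C a * X =
      (∑ x ∈ S.primePowers n with 2 ≤ x.2, (S.degree x.1 : ℝ[X]) * X ^ x.2) +
        C ((P : ℝ) - a) * X := by
    have h1 : ∑ x ∈ S.primePowers n with ¬ 2 ≤ x.2, (S.degree x.1 : ℝ[X]) * X ^ x.2 =
        C (P : ℝ) * X := by
      rw [hP, C_eq_natCast, Nat.cast_sum, sum_mul]
      refine sum_congr rfl fun x hx => ?_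
      simp only [mem_filter, mem_primePowers] at hx
      rw [show x.2 = 1 by omega, pow_one]
    rw [lambdaPoly, ← sum_filter_add_sum_filter_not _ (fun x : G × ℕ => 2 ≤ x.2), h1, C_sub]
    ring
  have h2 : Polynomial.length
      (∑ x ∈ S.primePowers n with 2 ≤ x.2, (S.degree x.1 : ℝ[X]) * X ^ x.2) ≤ R := by
    refine (length_sum_le _ _).trans ?_
    rw [hR, Nat.cast_sum]
    refine sum_le_sum fun x _ => ?_
    rw [← C_eq_natCast, C_mul_X_pow_eq_monomial, length_monomial, Nat.abs_cast]
  rw [hsplit]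
  refine (length_add_le _ _).trans ?_
  rw [length_C_mul, length_X, mul_one]
  have h3 : (P : ℝ) - a = ((S.chebyshev n : ℝ) - a) - R := by
    rw [← hRP]; push_cast; ring
  have h4 : |(P : ℝ) - a| ≤ |(S.chebyshev n : ℝ) - a| + R := by
    rw [h3]
    simpa using norm_sub_le ((S.chebyshev n : ℝ) - a) R
  linarith

end AdditiveArithmeticalSemigroup

/-! ### The Prime Number Theorem and comparison with cycle numbers -/

namespace AdditiveArithmeticalSemigroup
open Polynomial Finset

variable {G : Type*} [CommMonoid G] (S : AdditiveArithmeticalSemigroup G)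

theorem exists_forall_le_of_isBigO {f g : ℕ → ℝ} (hg : ∀ n, 0 < g n) (h : f =O[atTop] g) :
    ∃ K, 0 ≤ K ∧ ∀ n, |f n| ≤ K * g n := by
  obtain ⟨K, hK⟩ := (isBigO_nat_atTop_iff fun n hn => absurd hn (hg n).ne').1 h
  refine ⟨K, ?_, fun n => by simpa [abs_of_pos (hg n)] using hK n⟩
  have := (norm_nonneg _).trans (hK 0)
  exact nonneg_of_mul_nonneg_left this (norm_pos_iff.2 (hg 0).ne')

/-- Two errors compete: `q ^ (θ n)` from the Prime Number Theorem and `q ^ (n / 2)` from proper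
prime powers. Both are exponentially smaller than `q ^ n`. -/
theorem exists_length_lambdaPoly_sub_X_le {q η : ℝ} (hq : 1 < q) (hPNT : S.HasClassicalPNT q η) :
    ∃ K ρ : ℝ, 0 ≤ K ∧ 0 < ρ ∧ ρ < 1 ∧
      ∀ n, (C (q⁻¹ ^ n) * S.lambdaPoly n - X).length ≤ K * ρ ^ n := by
  obtain ⟨θ, -, hθ, hO⟩ := hPNT
  have hq0 : 0 < q := one_pos.trans hq
  obtain ⟨A, hA0, hA⟩ := exists_forall_le_of_isBigO (fun n => Real.rpow_pos_of_pos hq0 _) hO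
  have hrpow : ∀ n : ℕ, q ^ (θ * (n : ℝ)) = (q ^ θ) ^ n := fun n => by
    rw [Real.rpow_mul hq0.le, Real.rpow_natCast]
  have hθq : q ^ θ ≤ q := by
    simpa using Real.rpow_le_rpow_of_exponent_le hq.le hθ.le
  have hcheb : ∀ d, (S.chebyshev d : ℝ) ≤ (A + 1) * q ^ d := by
    intro d
    have h1 := (abs_le.1 (hA d)).2
    rw [hrpow] at h1
    have h2 : (q ^ θ) ^ d ≤ q ^ d := pow_le_pow_left₀ (Real.rpow_nonneg hq0.le _) hθq d
    nlinarith
  have hsum : ∀ n, ∑ d ∈ range (n / 2 + 1), (S.chebyshev d : ℝ) ≤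
      (A + 1) * (q / (q - 1)) * √q ^ n := by
    intro n
    have hq1 : 0 < q - 1 := by linarith
    have h1 : √q ^ (2 * (n / 2)) ≤ √q ^ n :=
      pow_le_pow_right₀ (Real.one_le_sqrt.2 hq.le) (Nat.mul_div_le n 2)
    rw [pow_mul, Real.sq_sqrt hq0.le] at h1
    calc ∑ d ∈ range (n / 2 + 1), (S.chebyshev d : ℝ)
        ≤ ∑ d ∈ range (n / 2 + 1), (A + 1) * q ^ d := sum_le_sum fun d _ => hcheb d
      _ = (A + 1) * ((q ^ (n / 2 + 1) - 1) / (q - 1)) := by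
          rw [← mul_sum, geom_sum_eq hq.ne']
      _ ≤ (A + 1) * ((q * q ^ (n / 2)) / (q - 1)) := by
          refine mul_le_mul_of_nonneg_left (div_le_div_of_nonneg_right ?_ hq1.le) (by linarith)
          rw [pow_succ']; linarith
      _ = (A + 1) * (q / (q - 1)) * q ^ (n / 2) := by ring
      _ ≤ _ := mul_le_mul_of_nonneg_left h1 (by positivity)
  set K := A + 2 * ((A + 1) * (q / (q - 1))) with hK
  have hq1 : 0 < q - 1 := by linarith
  have hqθ1 : q⁻¹ * q ^ θ < 1 := by
    rw [inv_mul_lt_iff₀ hq0, mul_one]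
    simpa using Real.rpow_lt_rpow_of_exponent_lt hq hθ
  have hqs1 : q⁻¹ * √q < 1 := by
    rw [inv_mul_lt_iff₀ hq0, mul_one]
    exact (Real.sqrt_lt' hq0).2 (by nlinarith)
  refine ⟨K, max (q⁻¹ * q ^ θ) (q⁻¹ * √q), by positivity, lt_max_of_lt_right (by positivity),
    max_lt hqθ1 hqs1, fun n => ?_⟩
  have e : C (q⁻¹ ^ n) * S.lambdaPoly n - X = C (q⁻¹ ^ n) * (S.lambdaPoly n - C (q ^ n) * X) := by
    rw [mul_sub, ← mul_assoc, ← C_mul, ← mul_pow, inv_mul_cancel₀ hq0.ne', one_pow, C_1, one_mul]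
  rw [e, length_C_mul, abs_of_pos (by positivity)]
  have h1 := S.length_lambdaPoly_sub_le n (q ^ n)
  have h2 := hA n
  rw [hrpow] at h2
  have h3 := hsum n
  have h4 : q⁻¹ ^ n * (q ^ θ) ^ n ≤ max (q⁻¹ * q ^ θ) (q⁻¹ * √q) ^ n := by
    rw [← mul_pow]
    exact pow_le_pow_left₀ (by positivity) (le_max_left _ _) n
  have h5 : q⁻¹ ^ n * √q ^ n ≤ max (q⁻¹ * q ^ θ) (q⁻¹ * √q) ^ n := by
    rw [← mul_pow]
    exact pow_le_pow_left₀ (by positivity) (le_max_right _ _) n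
  calc q⁻¹ ^ n * (S.lambdaPoly n - C (q ^ n) * X).length
      ≤ q⁻¹ ^ n * (A * (q ^ θ) ^ n + 2 * ((A + 1) * (q / (q - 1)) * √q ^ n)) :=
        mul_le_mul_of_nonneg_left (by linarith) (by positivity)
    _ = A * (q⁻¹ ^ n * (q ^ θ) ^ n) + 2 * ((A + 1) * (q / (q - 1))) * (q⁻¹ ^ n * √q ^ n) := by
        ring
    _ ≤ A * max (q⁻¹ * q ^ θ) (q⁻¹ * √q) ^ n +
        2 * ((A + 1) * (q / (q - 1))) * max (q⁻¹ * q ^ θ) (q⁻¹ * √q) ^ n := by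
        refine add_le_add (mul_le_mul_of_nonneg_left h4 hA0)
          (mul_le_mul_of_nonneg_left h5 (by positivity))
    _ = K * max (q⁻¹ * q ^ θ) (q⁻¹ * √q) ^ n := by rw [hK]; ring

/-- The generating polynomial of `Ω` on the elements of degree at most `n`. -/
noncomputable def omegaPolyLE (n : ℕ) : ℝ[X] := ∑ g ∈ S.degreeLE n, X ^ S.bigOmega g

theorem omegaPolyLE_eq_sum (n : ℕ) : S.omegaPolyLE n = ∑ m ∈ range (n + 1), S.omegaPoly m := by
  classical
  rw [omegaPolyLE, ← sum_fiberwise_of_maps_to (t := range (n + 1)) (g := S.degree)]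
  · refine sum_congr rfl fun m hm => sum_congr ?_ fun _ _ => rfl
    ext g
    have := mem_range.1 hm
    simp only [mem_filter, mem_degreeLE, mem_degreeEq]
    omega
  · intro g hg
    exact mem_range.2 (Nat.lt_succ_of_le (S.mem_degreeLE.1 hg))

/-- Passing from degree equal to `n` to degree at most `n` multiplies the rescaled series by `∑ q ^
(-i) u ^ i`, a summable factor that is absorbed into `h`. -/
theorem exists_omegaPolyLE_eq_sum_mul_cyclePoly {q η : ℝ} (hq : 1 < q)
    (hPNT : S.HasClassicalPNT q η) :
    ∃ h : ℕ → ℝ[X], (Summable fun n => (h n).length) ∧ ∀ n,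
      C (q⁻¹ ^ n) * S.omegaPolyLE n = ∑ i ∈ range (n + 1), h i * cyclePoly (n - i) := by
  have hq0 : 0 < q := one_pos.trans hq
  obtain ⟨K, ρ, hK, hρ0, hρ1, hlam⟩ := S.exists_length_lambdaPoly_sub_X_le hq hPNT
  obtain ⟨h, hs, hh⟩ := exists_eq_sum_mul_cyclePoly
    (v := fun n => C (q⁻¹ ^ n) * S.omegaPoly n) (lam := fun n => C (q⁻¹ ^ n) * S.lambdaPoly n)
    (by simp [S.lambdaPoly_zero]) (fun n => by
      rw [mul_left_comm, S.omegaPoly_recursion, mul_sum]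
      refine sum_congr rfl fun x hx => ?_
      rw [← HasAntidiagonal.mem_antidiagonal.1 hx, pow_add, C_mul]
      ring) hK hρ0 hρ1 fun m _ => hlam m
  refine ⟨fun n => ∑ x ∈ antidiagonal n, C (q⁻¹ ^ x.1) * h x.2, ?_, fun n => ?_⟩
  · have h1 : Summable fun n => ‖(h n).length‖ := by
      simpa only [Real.norm_eq_abs, abs_of_nonneg (length_nonneg _)] using hs
    have h2 : Summable fun n : ℕ => ‖q⁻¹ ^ n‖ :=
      (summable_geometric_of_lt_one (by positivity) (inv_lt_one_of_one_lt₀ hq)).norm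
    refine Summable.of_nonneg_of_le (fun n => length_nonneg _) (fun n => ?_)
      (summable_norm_sum_mul_antidiagonal_of_summable_norm h2 h1)
    refine (length_sum_le _ _).trans (le_trans (le_of_eq ?_) (le_abs_self _))
    exact sum_congr rfl fun x _ => by rw [length_C_mul, abs_of_pos (by positivity)]
  · have h1 : C (q⁻¹ ^ n) * S.omegaPolyLE n = PowerSeries.coeff n
        (PowerSeries.mk (fun i => C (q⁻¹ ^ i)) *
          PowerSeries.mk fun j => C (q⁻¹ ^ j) * S.omegaPoly j) := by
      rw [PowerSeries.coeff_mul, Nat.sum_antidiagonal_eq_sum_range_succ_mk, omegaPolyLE_eq_sum,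
        mul_sum, ← sum_range_reflect]
      refine sum_congr rfl fun i hi => ?_
      have hi := mem_range.1 hi
      simp only [PowerSeries.coeff_mk, Nat.add_sub_cancel]
      rw [← mul_assoc, ← C_mul, ← pow_add]
      congr 3
      omega
    have h2 : PowerSeries.mk (fun j => C (q⁻¹ ^ j) * S.omegaPoly j) =
        PowerSeries.mk h * PowerSeries.mk cyclePoly := by
      ext1 j
      rw [PowerSeries.coeff_mul, PowerSeries.coeff_mk, hh]
      simp only [PowerSeries.coeff_mk]
    rw [h1, h2, ← mul_assoc, PowerSeries.coeff_mul, Nat.sum_antidiagonal_eq_sum_range_succ_mk]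
    refine sum_congr rfl fun i _ => ?_
    simp only [PowerSeries.coeff_mk, PowerSeries.coeff_mul]

end AdditiveArithmeticalSemigroup

/-! ### Characteristic functions of cycle numbers -/

theorem norm_prod_sub_prod_le {ι R : Type*} [NormedCommRing R] [NormOneClass R] (s : Finset ι)
    {a b : ι → R} (ha : ∀ i ∈ s, ‖a i‖ ≤ 1) (hb : ∀ i ∈ s, ‖b i‖ ≤ 1) :
    ‖∏ i ∈ s, a i - ∏ i ∈ s, b i‖ ≤ ∑ i ∈ s, ‖a i - b i‖ := by
  classical
  induction s using Finset.induction_on with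
  | empty => simp
  | insert j s hj ih =>
    have ha' : ∀ i ∈ s, ‖a i‖ ≤ 1 := fun i hi => ha i (Finset.mem_insert_of_mem hi)
    have hb' : ∀ i ∈ s, ‖b i‖ ≤ 1 := fun i hi => hb i (Finset.mem_insert_of_mem hi)
    rw [Finset.prod_insert hj, Finset.prod_insert hj, Finset.sum_insert hj]
    have e : a j * ∏ i ∈ s, a i - b j * ∏ i ∈ s, b i =
        (a j - b j) * ∏ i ∈ s, a i + b j * (∏ i ∈ s, a i - ∏ i ∈ s, b i) := by ring
    have h1 : ‖∏ i ∈ s, a i‖ ≤ 1 :=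
      (Finset.norm_prod_le _ _).trans (Finset.prod_le_one (fun _ _ => norm_nonneg _) ha')
    rw [e]
    refine (norm_add_le _ _).trans (add_le_add ?_ ?_)
    · exact (norm_mul_le _ _).trans (mul_le_of_le_one_right (norm_nonneg _) h1)
    · refine (norm_mul_le _ _).trans ((mul_le_of_le_one_left (norm_nonneg _)
        (hb j (Finset.mem_insert_self _ _))).trans (ih ha' hb'))

namespace Polynomial

/-- Poisson approximation, uniform in `n`: the factors `1 + a (z - 1)` and `exp (a (z - 1))` both
lie in the unit disc and differ by at most `a² ‖z - 1‖²`, so the products differ by at most the sum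
of these. -/
theorem exists_norm_aeval_cyclePoly_sub_exp_le :
    ∃ K : ℝ, ∀ (z : ℂ) (n : ℕ), ‖z‖ ≤ 1 → ‖z - 1‖ ≤ 1 →
      ‖aeval z (cyclePoly n) - Complex.exp ((z - 1) * harmonicSum n)‖ ≤ K * ‖z - 1‖ ^ 2 := by
  have hs : Summable fun i : ℕ => (1 / ((i : ℝ) + 1)) ^ 2 := by
    refine ((summable_nat_add_iff 1).2 (Real.summable_one_div_nat_pow.2 one_lt_two)).congr
      fun i => ?_
    push_cast; rw [one_div_pow]
  refine ⟨∑' i : ℕ, (1 / ((i : ℝ) + 1)) ^ 2, fun z n hz hw => ?_⟩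
  have h1 : aeval z (cyclePoly n) =
      ∏ i ∈ Finset.range n, (1 + ((1 / ((i : ℝ) + 1) : ℝ) : ℂ) * (z - 1)) := by
    rw [cyclePoly, map_prod]
    exact Finset.prod_congr rfl fun i _ => by simp
  have h2 : Complex.exp ((z - 1) * harmonicSum n) =
      ∏ i ∈ Finset.range n, Complex.exp (((1 / ((i : ℝ) + 1) : ℝ) : ℂ) * (z - 1)) := by
    rw [harmonicSum, ← Complex.exp_sum, Complex.ofReal_sum, ← Finset.sum_mul, mul_comm]
  have ha1 := one_div_succ_le_one
  have ha0 : ∀ i : ℕ, 0 ≤ 1 / ((i : ℝ) + 1) := fun i => by positivity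
  have hre : (z - 1).re ≤ 0 := by
    rw [Complex.sub_re, Complex.one_re]
    linarith [(Complex.re_le_norm z).trans hz]
  rw [h1, h2]
  refine (norm_prod_sub_prod_le _ (fun i _ => ?_) fun i _ => ?_).trans ?_
  · set a := 1 / ((i : ℝ) + 1)
    have e : (1 : ℂ) + (a : ℂ) * (z - 1) = ((1 - a : ℝ) : ℂ) + a * z := by push_cast; ring
    rw [e]
    refine (norm_add_le _ _).trans ?_
    rw [norm_mul, Complex.norm_real, Complex.norm_real, Real.norm_of_nonneg (ha0 i),
      Real.norm_of_nonneg (sub_nonneg.2 (ha1 i))]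
    nlinarith [ha0 i]
  · rw [Complex.norm_exp, Complex.re_ofReal_mul]
    exact Real.exp_le_one_iff.2 (mul_nonpos_of_nonneg_of_nonpos (ha0 i) hre)
  · refine le_trans ?_ (mul_le_mul_of_nonneg_right
      (hs.sum_le_tsum (Finset.range n) fun i _ => by positivity) (by positivity))
    rw [Finset.sum_mul]
    refine Finset.sum_le_sum fun i _ => ?_
    set a := 1 / ((i : ℝ) + 1)
    have hn : ‖(a : ℂ) * (z - 1)‖ = a * ‖z - 1‖ := by
      rw [norm_mul, Complex.norm_real, Real.norm_of_nonneg (ha0 i)]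
    have h3 := Complex.norm_exp_sub_one_sub_id_le (x := (a : ℂ) * (z - 1))
      (by rw [hn]; nlinarith [ha0 i, ha1 i, norm_nonneg (z - 1)])
    rw [hn, mul_pow] at h3
    rwa [← norm_neg, neg_sub, ← sub_sub]

theorem harmonicSum_eq_harmonic (n : ℕ) : harmonicSum n = harmonic n := by
  rw [harmonicSum, harmonic]
  push_cast
  exact Finset.sum_congr rfl fun i _ => one_div _

theorem tendsto_harmonicSum_sub_sub_log (j : ℕ) :
    Tendsto (fun n : ℕ => harmonicSum (n - j) - Real.log n) atTop
      (𝓝 Real.eulerMascheroniConstant) := by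
  rw [← tendsto_add_atTop_iff_nat j]
  have h1 := Real.tendsto_harmonic_sub_log
  have h2 := (Real.tendsto_log_comp_add_sub_log j).comp tendsto_natCast_atTop_atTop
  have h3 := h1.sub h2
  rw [sub_zero] at h3
  refine h3.congr fun n => ?_
  rw [Nat.add_sub_cancel, harmonicSum_eq_harmonic, Function.comp_apply]
  push_cast
  ring

/-- The logarithm of the characteristic function of a centred Poisson variable of mean `l`, scaled
by `√l`. The second-order Taylor term gives the limit, and the cubic remainder is at most `|t| ^ 3 /
√l`. -/
theorem tendsto_exp_sub_one_mul_sub {l : ℕ → ℝ} (hl : Tendsto l atTop atTop) (t : ℝ) :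
    Tendsto (fun n => (Complex.exp (Complex.I * ((t / √(l n) : ℝ) : ℂ)) - 1) * (l n : ℂ) -
      Complex.I * ((t * √(l n) : ℝ) : ℂ)) atTop (𝓝 (-(t : ℂ) ^ 2 / 2)) := by
  have hsq : Tendsto (fun n => √(l n)) atTop atTop := Real.tendsto_sqrt_atTop.comp hl
  rw [tendsto_iff_norm_sub_tendsto_zero]
  have hlim : Tendsto (fun n => |t| ^ 3 / √(l n)) atTop (𝓝 0) := hsq.const_div_atTop _
  refine squeeze_zero' (Eventually.of_forall fun _ => norm_nonneg _) ?_ hlim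
  filter_upwards [hl.eventually_gt_atTop 0, hsq.eventually_ge_atTop |t|] with n hn ht
  have hs : 0 < √(l n) := Real.sqrt_pos.2 hn
  set s := √(l n) with hsdef
  have hls : l n = s ^ 2 := (Real.sq_sqrt hn.le).symm
  have hsC : (s : ℂ) ≠ 0 := by exact_mod_cast hs.ne'
  set x : ℂ := Complex.I * ((t / s : ℝ) : ℂ) with hx
  have hxn : ‖x‖ = |t| / s := by
    rw [hx, norm_mul, Complex.norm_I, one_mul, Complex.norm_real, Real.norm_eq_abs, abs_div,
      abs_of_pos hs]
  have hb := Complex.exp_bound (x := x) (by rw [hxn]; exact (div_le_one hs).2 ht) (n := 3)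
    (by norm_num)
  have hx2 : x ^ 2 * (s : ℂ) ^ 2 = -(t : ℂ) ^ 2 := by
    rw [hx, mul_pow, Complex.I_sq]; push_cast; field_simp
  have hx1 : x * (s : ℂ) ^ 2 = Complex.I * ((t * s : ℝ) : ℂ) := by
    rw [hx]; push_cast; field_simp
  have e : (Complex.exp x - 1) * (l n : ℂ) - Complex.I * ((t * s : ℝ) : ℂ) - -(t : ℂ) ^ 2 / 2 =
      (Complex.exp x - ∑ m ∈ Finset.range 3, x ^ m / m.factorial) * (s : ℂ) ^ 2 := by
    rw [← hx1, ← hx2, hls]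
    simp only [Finset.sum_range_succ, Finset.sum_range_zero, Nat.factorial]
    push_cast
    ring
  rw [e, norm_mul, norm_pow, Complex.norm_real, Real.norm_of_nonneg hs.le]
  calc _ ≤ ‖x‖ ^ 3 * s ^ 2 := by
        refine mul_le_mul_of_nonneg_right (hb.trans ?_) (by positivity)
        refine mul_le_of_le_one_right (by positivity) ?_
        norm_num [Nat.factorial]
    _ = |t| ^ 3 / s := by rw [hxn]; field_simp

theorem norm_exp_I_mul_ofReal (x : ℝ) : ‖Complex.exp (Complex.I * (x : ℂ))‖ = 1 := by
  rw [mul_comm, Complex.norm_exp_ofReal_mul_I]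

/-- The characteristic functions of the normalized cycle numbers converge to that of the standard
normal law. -/
theorem tendsto_aeval_cyclePoly_sub (t : ℝ) (j : ℕ) :
    Tendsto (fun n : ℕ =>
      aeval (Complex.exp (Complex.I * ((t / √(Real.log n) : ℝ) : ℂ))) (cyclePoly (n - j)) *
        Complex.exp (-(Complex.I * ((t * √(Real.log n) : ℝ) : ℂ)))) atTop
      (𝓝 (Complex.exp (-(t : ℂ) ^ 2 / 2))) := by
  have hlog : Tendsto (fun n : ℕ => Real.log n) atTop atTop :=
    Real.tendsto_log_atTop.comp tendsto_natCast_atTop_atTop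
  have hsq : Tendsto (fun n : ℕ => √(Real.log n)) atTop atTop :=
    Real.tendsto_sqrt_atTop.comp hlog
  set z : ℕ → ℂ := fun n => Complex.exp (Complex.I * ((t / √(Real.log n) : ℝ) : ℂ)) with hz
  have hznorm : ∀ n, ‖z n‖ = 1 := fun n => norm_exp_I_mul_ofReal _
  have hw : Tendsto (fun n => z n - 1) atTop (𝓝 0) := by
    have h1 : Tendsto (fun n : ℕ => Complex.I * ((t / √(Real.log n) : ℝ) : ℂ)) atTop
        (𝓝 (Complex.I * ((0 : ℝ) : ℂ))) :=
      (((Complex.continuous_ofReal.tendsto 0).comp (hsq.const_div_atTop t))).const_mul _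
    have h2 := ((Complex.continuous_exp.tendsto _).comp h1).sub_const 1
    rw [Complex.ofReal_zero, mul_zero, Complex.exp_zero, sub_self] at h2
    exact h2
  obtain ⟨K, hK⟩ := exists_norm_aeval_cyclePoly_sub_exp_le
  have hmain : Tendsto (fun n => Complex.exp ((z n - 1) * harmonicSum (n - j)) *
      Complex.exp (-(Complex.I * ((t * √(Real.log n) : ℝ) : ℂ)))) atTop
      (𝓝 (Complex.exp (-(t : ℂ) ^ 2 / 2))) := by
    -- Replacing `harmonicSum (n - j)` by `log n` costs `z - 1 → 0` times a convergent factor.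
    have h1 := hw.mul ((Complex.continuous_ofReal.tendsto _).comp
      (tendsto_harmonicSum_sub_sub_log j))
    have h2 := h1.add (tendsto_exp_sub_one_mul_sub hlog t)
    rw [zero_mul, zero_add] at h2
    refine ((Complex.continuous_exp.tendsto _).comp h2).congr fun n => ?_
    rw [← Complex.exp_add]
    simp only [Function.comp_apply, Complex.ofReal_sub, hz]
    congr 1
    ring
  refine tendsto_of_tendsto_of_dist hmain ?_
  have hlim : Tendsto (fun n => K * ‖z n - 1‖ ^ 2) atTop (𝓝 0) := by
    simpa using ((hw.norm.pow 2).const_mul K)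
  refine squeeze_zero' (Eventually.of_forall fun _ => dist_nonneg) ?_ hlim
  have hev : ∀ᶠ n in atTop, ‖z n - 1‖ ≤ 1 := by
    have := hw.norm
    rw [norm_zero] at this
    exact (this.eventually_lt_const one_pos).mono fun n hn => hn.le
  filter_upwards [hev] with n hn
  rw [dist_comm, dist_eq_norm, ← sub_mul, norm_mul, ← mul_neg, ← Complex.ofReal_neg,
    norm_exp_I_mul_ofReal, mul_one]
  exact hK (z n) (n - j) (hznorm n).le hn

end Polynomial

/-! ### Transfer to `Ω`: shift invariance and Erdős–Kac -/

/-- The law of `y` under the uniform distribution on the finite set `s`. -/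
noncomputable def uniformLaw {ι Ω : Type*} [MeasurableSpace Ω] (s : Finset ι) (y : ι → Ω) :
    Measure Ω :=
  (s.card : ENNReal)⁻¹ • ∑ i ∈ s, Measure.dirac (y i)

theorem isProbabilityMeasure_uniformLaw {ι Ω : Type*} [MeasurableSpace Ω] {s : Finset ι}
    (hs : s.Nonempty) (y : ι → Ω) : IsProbabilityMeasure (uniformLaw s y) := by
  refine ⟨?_⟩
  simp only [uniformLaw, Measure.smul_apply, Measure.finsetSum_apply, measure_univ,
    Finset.sum_const, smul_eq_mul, nsmul_eq_mul, mul_one]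
  exact ENNReal.inv_mul_cancel (by exact_mod_cast hs.card_ne_zero) (ENNReal.natCast_ne_top _)

theorem integral_uniformLaw {ι Ω E : Type*} [MeasurableSpace Ω] [MeasurableSingletonClass Ω]
    [NormedAddCommGroup E] [NormedSpace ℝ E] [CompleteSpace E] (s : Finset ι) (y : ι → Ω)
    (f : Ω → E) : ∫ ω, f ω ∂(uniformLaw s y) = (s.card : ℝ)⁻¹ • ∑ i ∈ s, f (y i) := by
  rw [uniformLaw, integral_smul_measure, integral_finsetSum_measure]
  · simp
  · intro i _
    exact integrable_dirac enorm_lt_top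

namespace AdditiveArithmeticalSemigroup
open Polynomial Finset

variable {G : Type*} [CommMonoid G] (S : AdditiveArithmeticalSemigroup G)

theorem nonempty_degreeLE (n : ℕ) : (S.degreeLE n).Nonempty :=
  ⟨1, S.mem_degreeLE.2 (by rw [S.degree_one]; exact Nat.zero_le n)⟩

theorem aeval_one_omegaPolyLE (n : ℕ) : aeval (1 : ℂ) (S.omegaPolyLE n) = (S.degreeLE n).card := by
  simp [omegaPolyLE]

theorem pairing_omegaPolyLE (n : ℕ) (φ : ℕ → ℂ) :
    (S.omegaPolyLE n).pairing φ = ∑ g ∈ S.degreeLE n, φ (S.bigOmega g) := by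
  rw [omegaPolyLE, pairing_sum]
  refine sum_congr rfl fun g _ => ?_
  rw [← monomial_one_right_eq_X_pow, pairing_monomial, Complex.ofReal_one, one_mul]

variable {S} {c q η : ℝ}

/-- Evaluating the convolution at `1` gives a convergent series. Its positivity comes from Axiom A#:
the limit dominates that of `q ^ (-n) G(n)`, which is `c`. -/
theorem exists_tendsto_card_degreeLE (hA : S.IsAxiomASharp c q η) (hPNT : S.HasClassicalPNT q η) :
    ∃ K : ℝ, 0 < K ∧ Tendsto (fun n => q⁻¹ ^ n * ((S.degreeLE n).card : ℝ)) atTop (𝓝 K) := by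
  obtain ⟨hc, hq, -, hη, hO⟩ := hA
  have hq0 : 0 < q := one_pos.trans hq
  obtain ⟨h, hs, hh⟩ := S.exists_omegaPolyLE_eq_sum_mul_cyclePoly hq hPNT
  have heval : ∀ p : ℝ[X], ‖p.eval 1‖ ≤ p.length := fun p => by
    rw [eval_eq_sum, length, sum_def, sum_def]
    refine (norm_sum_le _ _).trans (le_of_eq (sum_congr rfl fun k _ => by simp))
  have hlim : Tendsto (fun n => q⁻¹ ^ n * ((S.degreeLE n).card : ℝ)) atTop
      (𝓝 (∑' i, (h i).eval 1)) := by
    have := tendsto_sum_range_succ_of_dominated (f := fun _ i => (h i).eval 1) hs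
      (fun i => tendsto_const_nhds) fun n i _ => heval (h i)
    refine this.congr fun n => ?_
    have e := congrArg (eval 1) (hh n)
    simp only [eval_mul, eval_C, eval_finsetSum, eval_one_cyclePoly, mul_one] at e
    rw [← e]
    congr 1
    simp [omegaPolyLE, eval_finsetSum]
  refine ⟨_, ?_, hlim⟩
  have hcount : Tendsto (fun n => q⁻¹ ^ n * (S.count n : ℝ)) atTop (𝓝 c) := by
    obtain ⟨A, hA0, hA⟩ := exists_forall_le_of_isBigO (fun n => Real.rpow_pos_of_pos hq0 _) hO
    have hr : q⁻¹ * q ^ η < 1 := by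
      rw [inv_mul_lt_iff₀ hq0, mul_one]
      simpa using Real.rpow_lt_rpow_of_exponent_lt hq hη
    rw [tendsto_iff_norm_sub_tendsto_zero]
    have hz : Tendsto (fun n => A * (q⁻¹ * q ^ η) ^ n) atTop (𝓝 0) := by
      simpa using (tendsto_pow_atTop_nhds_zero_of_lt_one (by positivity) hr).const_mul A
    refine squeeze_zero (fun _ => norm_nonneg _) (fun n => ?_) hz
    have e : q⁻¹ ^ n * (S.count n : ℝ) - c = q⁻¹ ^ n * ((S.count n : ℝ) - c * q ^ n) := by
      rw [mul_sub, mul_left_comm _ c, ← mul_pow, inv_mul_cancel₀ hq0.ne', one_pow, mul_one]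
    have h1 := hA n
    rw [Real.rpow_mul hq0.le, Real.rpow_natCast] at h1
    rw [e, norm_mul, Real.norm_of_nonneg (by positivity), Real.norm_eq_abs, mul_pow, mul_left_comm]
    exact mul_le_mul_of_nonneg_left h1 (by positivity)
  refine hc.trans_le (le_of_tendsto_of_tendsto' hcount hlim fun n => ?_)
  refine mul_le_mul_of_nonneg_left ?_ (by positivity)
  rw [← S.card_degreeEq]
  exact_mod_cast card_le_card fun g hg => S.mem_degreeLE.2 (S.mem_degreeEq.1 hg).le

/-- The law of `Ω` on the elements of degree at most `n` is asymptotically shift invariant in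
total variation. -/
theorem tendsto_length_X_sub_one_mul_omegaPolyLE (hA : S.IsAxiomASharp c q η)
    (hPNT : S.HasClassicalPNT q η) :
    Tendsto (fun n => ((X - 1) * S.omegaPolyLE n).length / ((S.degreeLE n).card : ℝ))
      atTop (𝓝 0) := by
  have hq : 1 < q := hA.2.1
  have hq0 : 0 < q := one_pos.trans hq
  obtain ⟨K, hK, hcard⟩ := exists_tendsto_card_degreeLE hA hPNT
  obtain ⟨h, hs, hh⟩ := S.exists_omegaPolyLE_eq_sum_mul_cyclePoly hq hPNT
  have hnum : Tendsto (fun n => q⁻¹ ^ n * ((X - 1) * S.omegaPolyLE n).length) atTop (𝓝 0) := by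
    -- For each fixed `i` the cycle law becomes shift invariant; the dominating constant `2` bounds
    -- the length of `X - 1`.
    have hlim := tendsto_sum_range_succ_of_dominated (hs.mul_right 2)
      (f := fun n i => (h i).length * ((X - 1) * cyclePoly (n - i)).length) (g := fun _ => 0)
      (fun i => ?_) fun n i _ => ?_
    · rw [tsum_zero] at hlim
      refine squeeze_zero (fun n => mul_nonneg (by positivity) (length_nonneg _)) (fun n => ?_) hlim
      rw [← abs_of_pos (pow_pos (inv_pos.2 hq0) n), ← length_C_mul, mul_left_comm, hh, mul_sum]
      refine (length_sum_le _ _).trans (sum_le_sum fun i _ => ?_)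
      rw [mul_left_comm]
      exact length_mul_le _ _
    · simpa using (tendsto_length_X_sub_one_mul_cyclePoly.comp
        (tendsto_sub_atTop_nat i)).const_mul (h i).length
    · rw [Real.norm_of_nonneg (mul_nonneg (length_nonneg _) (length_nonneg _))]
      refine mul_le_mul_of_nonneg_left ((length_mul_le _ _).trans ?_) (length_nonneg _)
      rw [length_cyclePoly, mul_one]
      refine (length_sub_le _ _).trans ?_
      rw [length_X, length_one]; norm_num
  have := hnum.div hcard hK.ne'
  rw [zero_div] at this
  refine this.congr fun n => ?_
  exact mul_div_mul_left _ _ (pow_ne_zero _ (inv_ne_zero hq0.ne'))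

theorem tendsto_aeval_omegaPolyLE (hA : S.IsAxiomASharp c q η) (hPNT : S.HasClassicalPNT q η)
    (t : ℝ) :
    Tendsto (fun n : ℕ =>
      aeval (Complex.exp (Complex.I * ((t / √(Real.log n) : ℝ) : ℂ))) (S.omegaPolyLE n) *
        Complex.exp (-(Complex.I * ((t * √(Real.log n) : ℝ) : ℂ))) / (S.degreeLE n).card) atTop
      (𝓝 (Complex.exp (-(t : ℂ) ^ 2 / 2))) := by
  have hq : 1 < q := hA.2.1
  have hq0 : 0 < q := one_pos.trans hq
  obtain ⟨K, hK, hcard⟩ := exists_tendsto_card_degreeLE hA hPNT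
  obtain ⟨h, hs, hh⟩ := S.exists_omegaPolyLE_eq_sum_mul_cyclePoly hq hPNT
  set z : ℕ → ℂ := fun n => Complex.exp (Complex.I * ((t / √(Real.log n) : ℝ) : ℂ)) with hz
  set e : ℕ → ℂ := fun n => Complex.exp (-(Complex.I * ((t * √(Real.log n) : ℝ) : ℂ))) with he
  have hznorm : ∀ n, ‖z n‖ = 1 := fun n => norm_exp_I_mul_ofReal _
  have henorm : ∀ n, ‖e n‖ = 1 := fun n => by
    rw [he]
    simp only []
    rw [← mul_neg, ← Complex.ofReal_neg, norm_exp_I_mul_ofReal]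
  have hz1 : Tendsto z atTop (𝓝 1) := by
    have hsq : Tendsto (fun n : ℕ => √(Real.log n)) atTop atTop :=
      Real.tendsto_sqrt_atTop.comp (Real.tendsto_log_atTop.comp tendsto_natCast_atTop_atTop)
    have h1 : Tendsto (fun n : ℕ => Complex.I * ((t / √(Real.log n) : ℝ) : ℂ)) atTop
        (𝓝 (Complex.I * ((0 : ℝ) : ℂ))) :=
      (((Complex.continuous_ofReal.tendsto 0).comp (hsq.const_div_atTop t))).const_mul _
    have h2 := (Complex.continuous_exp.tendsto _).comp h1
    rw [Complex.ofReal_zero, mul_zero, Complex.exp_zero] at h2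
    exact h2
  have hscaled : ∀ n (w : ℂ), aeval w (C (q⁻¹ ^ n) * S.omegaPolyLE n) =
      ((q⁻¹ ^ n : ℝ) : ℂ) * aeval w (S.omegaPolyLE n) := fun n w => by
    rw [map_mul, aeval_C]; rfl
  have hden : Tendsto (fun n => ((q⁻¹ ^ n : ℝ) : ℂ) * (S.degreeLE n).card) atTop (𝓝 (K : ℂ)) := by
    refine ((Complex.continuous_ofReal.tendsto K).comp hcard).congr fun n => ?_
    simp only [Function.comp_apply]
    push_cast
    rfl
  have hsum1 : (∑' i, aeval (1 : ℂ) (h i)) = K := by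
    refine tendsto_nhds_unique ?_ hden
    have := tendsto_sum_range_succ_of_dominated (f := fun _ i => aeval (1 : ℂ) (h i)) hs
      (fun i => tendsto_const_nhds) fun n i _ => norm_aeval_le_length (h i) (by simp)
    refine this.congr fun n => ?_
    rw [← S.aeval_one_omegaPolyLE, ← hscaled, hh, map_sum]
    refine sum_congr rfl fun i _ => ?_
    have h1 : aeval (1 : ℂ) (cyclePoly (n - i)) = 1 := by
      have := aeval_algebraMap_apply ℂ (1 : ℝ) (cyclePoly (n - i))
      simpa using this
    rw [map_mul, h1, mul_one]
  have hnum : Tendsto (fun n => ((q⁻¹ ^ n : ℝ) : ℂ) * (aeval (z n) (S.omegaPolyLE n) * e n)) atTop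
      (𝓝 (K * Complex.exp (-(t : ℂ) ^ 2 / 2))) := by
    -- Since `z n → 1`, each `h i` contributes only its value at `1`. The perturbation thus amounts
    -- to the constant `K`, which the normalization by the cardinality cancels.
    have hlim := tendsto_sum_range_succ_of_dominated hs
      (f := fun n i => aeval (z n) (h i) * (aeval (z n) (cyclePoly (n - i)) * e n))
      (g := fun i => aeval (1 : ℂ) (h i) * Complex.exp (-(t : ℂ) ^ 2 / 2))
      (fun i => ?_) fun n i _ => ?_
    · rw [tsum_mul_right, hsum1] at hlim
      refine hlim.congr fun n => ?_
      rw [← mul_assoc, ← hscaled, hh, map_sum, sum_mul]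
      exact sum_congr rfl fun i _ => by rw [map_mul, mul_assoc]
    · exact (((h i).continuous_aeval.tendsto 1).comp hz1).mul (tendsto_aeval_cyclePoly_sub t i)
    · rw [norm_mul, norm_mul, henorm, mul_one]
      have h1 := norm_aeval_le_length (cyclePoly (n - i)) (hznorm n).le
      rw [length_cyclePoly] at h1
      exact (mul_le_of_le_one_right (norm_nonneg _) h1).trans
        (norm_aeval_le_length _ (hznorm n).le)
  have hKC : (K : ℂ) ≠ 0 := by exact_mod_cast hK.ne'
  have := hnum.div hden hKC
  rw [mul_div_cancel_left₀ _ hKC] at this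
  refine this.congr fun n => ?_
  exact mul_div_mul_left _ _ (by exact_mod_cast pow_ne_zero _ (inv_ne_zero hq0.ne'))

/-- The normalized value `(Ω - log n) / √(log n)`. -/
noncomputable def normalize (n k : ℕ) : ℝ := ((k : ℝ) - Real.log n) / √(Real.log n)

/-- The Erdős–Kac theorem for `Ω`. -/
theorem tendsto_sum_normalize_bigOmega (hA : S.IsAxiomASharp c q η) (hPNT : S.HasClassicalPNT q η)
    (F : BoundedContinuousFunction ℝ ℂ) :
    Tendsto (fun n : ℕ => ((S.degreeLE n).card : ℂ)⁻¹ *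
        ∑ g ∈ S.degreeLE n, F (normalize n (S.bigOmega g))) atTop
      (𝓝 (∫ t, F t ∂(ProbabilityTheory.gaussianReal 0 1))) := by
  set P : ℕ → ProbabilityMeasure ℝ := fun n =>
    ⟨uniformLaw (S.degreeLE n) fun g => normalize n (S.bigOmega g),
      isProbabilityMeasure_uniformLaw (S.nonempty_degreeLE n) _⟩ with hP
  set P₀ : ProbabilityMeasure ℝ := ⟨ProbabilityTheory.gaussianReal 0 1, inferInstance⟩ with hP₀
  have hconv : Tendsto P atTop (𝓝 P₀) := by
    refine ProbabilityMeasure.tendsto_iff_tendsto_charFun.2 fun t => ?_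
    have h0 : charFun (P₀ : Measure ℝ) t = Complex.exp (-(t : ℂ) ^ 2 / 2) := by
      change charFun (ProbabilityTheory.gaussianReal 0 1) t = _
      rw [ProbabilityTheory.charFun_gaussianReal]
      congr 1
      push_cast
      ring
    rw [h0]
    refine (tendsto_aeval_omegaPolyLE hA hPNT t).congr' ?_
    have hlog : Tendsto (fun n : ℕ => Real.log n) atTop atTop :=
      Real.tendsto_log_atTop.comp tendsto_natCast_atTop_atTop
    -- The identity between the two phases divides by `√(log n)`, hence needs `log n > 0`.
    filter_upwards [hlog.eventually_gt_atTop 0] with n hn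
    change _ = charFun (uniformLaw (S.degreeLE n) fun g => normalize n (S.bigOmega g)) t
    rw [charFun_apply_real, integral_uniformLaw, ← pairing_pow, pairing_omegaPolyLE, sum_mul,
      div_eq_inv_mul, Complex.real_smul, Complex.ofReal_inv, Complex.ofReal_natCast]
    congr 1
    refine sum_congr rfl fun g _ => ?_
    rw [← Complex.exp_nat_mul, ← Complex.exp_add]
    congr 1
    rw [normalize]
    have hs : 0 < √(Real.log n) := Real.sqrt_pos.2 hn
    have hl : Real.log n = √(Real.log n) ^ 2 := (Real.sq_sqrt hn.le).symm
    have e : t * (((S.bigOmega g : ℝ) - Real.log n) / √(Real.log n)) =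
        S.bigOmega g * (t / √(Real.log n)) - t * √(Real.log n) := by
      set s := √(Real.log n)
      rw [hl]
      field_simp
    rw [← Complex.ofReal_mul, e]
    push_cast
    ring
  have := (ProbabilityMeasure.tendsto_iff_forall_integral_rclike_tendsto ℂ).1 hconv F
  refine this.congr fun n => ?_
  change ∫ t, F t ∂(uniformLaw (S.degreeLE n) fun g => normalize n (S.bigOmega g)) = _
  rw [integral_uniformLaw, Complex.real_smul, Complex.ofReal_inv, Complex.ofReal_natCast]

end AdditiveArithmeticalSemigroup

/-! ### Uniform ergodic averages -/

/-- Otherwise some orbit averages of every length stay away from the integral. A limit point of the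
corresponding empirical measures exists by compactness, is invariant by telescoping, and so equals
`μ`, a contradiction. Uniformity in `x` matters because the bound is applied at all points `T^[k]
x`. -/
theorem IsUniquelyErgodic.exists_norm_average_sub_integral_le {X : Type*} [MetricSpace X]
    [CompactSpace X] [MeasurableSpace X] [BorelSpace X] {μ : Measure X} {T : X → X}
    (hT : IsUniquelyErgodic μ T) {f : X → ℂ} (hf : Continuous f) {ε : ℝ} (hε : 0 < ε) :
    ∃ N : ℕ, 0 < N ∧
      ∀ x, ‖(N : ℂ)⁻¹ * ∑ i ∈ Finset.range N, f (T^[i] x) - ∫ y, f y ∂μ‖ ≤ ε := by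
  by_contra! hcon
  choose x hx using fun n : ℕ => hcon (n + 1) n.succ_pos
  have hprob : ∀ n, IsProbabilityMeasure
      (uniformLaw (Finset.range (n + 1)) fun i => T^[i] (x n)) := fun n =>
    isProbabilityMeasure_uniformLaw ⟨0, Finset.mem_range.2 n.succ_pos⟩ _
  set P : ℕ → ProbabilityMeasure X := fun n => ⟨_, hprob n⟩ with hP
  set U : Ultrafilter ℕ := hyperfilter ℕ
  have hU : (U : Filter ℕ) ≤ atTop := Nat.hyperfilter_le_atTop
  obtain ⟨ν, -, hν⟩ := isCompact_univ.ultrafilter_le_nhds (U.map P) (by simp)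
  have hν' : Tendsto P U (𝓝 ν) := hν
  have hint : ∀ g : X → ℂ, Continuous g → Tendsto (fun n => ((n + 1 : ℕ) : ℂ)⁻¹ *
      ∑ i ∈ Finset.range (n + 1), g (T^[i] (x n))) U (𝓝 (∫ y, g y ∂(ν : Measure X))) := by
    intro g hg
    have := (ProbabilityMeasure.tendsto_iff_forall_integral_rclike_tendsto ℂ).1 hν'
      (BoundedContinuousFunction.mkOfCompact ⟨g, hg⟩)
    refine this.congr fun n => ?_
    change ∫ y, g y ∂(uniformLaw (Finset.range (n + 1)) fun i => T^[i] (x n)) = _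
    rw [integral_uniformLaw, Complex.real_smul, Complex.ofReal_inv, Complex.ofReal_natCast,
      Finset.card_range]
  have hinv : ∀ g : X → ℂ, Continuous g →
      ∫ y, g (T y) ∂(ν : Measure X) = ∫ y, g y ∂(ν : Measure X) := by
    intro g hg
    refine sub_eq_zero.1 (tendsto_nhds_unique
      ((hint (fun y => g (T y)) (hg.comp hT.continuous)).sub (hint g hg)) ?_)
    obtain ⟨B, hB⟩ := isCompact_univ.exists_bound_of_continuousOn hg.continuousOn
    refine Tendsto.mono_left ?_ hU
    have hlim : Tendsto (fun n : ℕ => (2 * B) / ((n : ℝ) + 1)) atTop (𝓝 0) :=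
      (tendsto_atTop_add_const_right _ 1 tendsto_natCast_atTop_atTop).const_div_atTop _
    refine squeeze_zero_norm (fun n => ?_) hlim
    have htel : ∑ i ∈ Finset.range (n + 1), g (T (T^[i] (x n))) -
        ∑ i ∈ Finset.range (n + 1), g (T^[i] (x n)) = g (T^[n + 1] (x n)) - g (x n) := by
      rw [← Finset.sum_sub_distrib]
      refine Eq.trans ?_ (Finset.sum_range_sub (fun i => g (T^[i] (x n))) (n + 1))
      refine Finset.sum_congr rfl fun i _ => ?_
      rw [Function.iterate_succ_apply']
    rw [← mul_sub, htel, norm_mul, norm_inv, Complex.norm_natCast, inv_mul_eq_div]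
    push_cast
    refine div_le_div_of_nonneg_right ?_ (by positivity)
    refine (norm_sub_le _ _).trans ?_
    linarith [hB (T^[n + 1] (x n)) (Set.mem_univ _), hB (x n) (Set.mem_univ _)]
  have hmap : (ν : Measure X).map T = ν := by
    have : IsProbabilityMeasure ((ν : Measure X).map T) :=
      Measure.isProbabilityMeasure_map hT.continuous.measurable.aemeasurable
    refine ext_of_forall_integral_eq_of_IsFiniteMeasure fun g => ?_
    rw [integral_map hT.continuous.measurable.aemeasurable g.continuous.aestronglyMeasurable]
    have h1 := hinv (fun y => ((g y : ℝ) : ℂ)) (Complex.continuous_ofReal.comp g.continuous)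
    rw [integral_complex_ofReal, integral_complex_ofReal] at h1
    exact_mod_cast h1
  have heq : (ν : Measure X) = μ :=
    hT.unique ν inferInstance ⟨hT.continuous.measurable, hmap⟩
  have hlim := hint f hf
  rw [heq] at hlim
  have h1 := (tendsto_iff_norm_sub_tendsto_zero.1 hlim).eventually_lt_const hε
  obtain ⟨n, hn⟩ := h1.exists
  exact absurd hn (hx n).not_gt

/-! ### Averaging along the orbit -/

namespace AdditiveArithmeticalSemigroup
open Polynomial Finset

variable {G : Type*} [CommMonoid G] (S : AdditiveArithmeticalSemigroup G)

/-- The average of `φ (Ω g)` over the elements `g` of degree at most `n`. -/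
noncomputable def average (n : ℕ) (φ : ℕ → ℂ) : ℂ :=
  ((S.degreeLE n).card : ℂ)⁻¹ * ∑ g ∈ S.degreeLE n, φ (S.bigOmega g)

theorem average_sub (n : ℕ) (φ ψ : ℕ → ℂ) :
    (S.average n fun k => φ k - ψ k) = S.average n φ - S.average n ψ := by
  rw [average, average, average, sum_sub_distrib, mul_sub]

theorem average_mul_right (n : ℕ) (φ : ℕ → ℂ) (a : ℂ) :
    (S.average n fun k => φ k * a) = S.average n φ * a := by
  rw [average, average, ← sum_mul, mul_assoc]

theorem average_sum {ι : Type*} (n : ℕ) (s : Finset ι) (φ : ι → ℕ → ℂ) :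
    (S.average n fun k => ∑ i ∈ s, φ i k) = ∑ i ∈ s, S.average n (φ i) := by
  simp only [average]
  rw [sum_comm, mul_sum]

theorem norm_average_le {n : ℕ} {φ : ℕ → ℂ} {M : ℝ} (h : ∀ k, ‖φ k‖ ≤ M) :
    ‖S.average n φ‖ ≤ M := by
  have hc : (0 : ℝ) < (S.degreeLE n).card := by
    exact_mod_cast (S.nonempty_degreeLE n).card_pos
  rw [average, norm_mul, norm_inv, Complex.norm_natCast, inv_mul_le_iff₀ hc, ← nsmul_eq_mul]
  exact (norm_sum_le _ _).trans (sum_le_card_nsmul _ _ _ fun g _ => h _)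

variable {S} {c q η : ℝ}

/-- One shift changes the average by a pairing with `(X - 1) * omegaPolyLE n`, which is controlled
by its length alone. Hence `φ` may vary with `n`, as the Erdős–Kac weight does. -/
theorem tendsto_average_shift_sub (hA : S.IsAxiomASharp c q η) (hPNT : S.HasClassicalPNT q η)
    {φ : ℕ → ℕ → ℂ} {M : ℝ} (hφ : ∀ n k, ‖φ n k‖ ≤ M) (i : ℕ) :
    Tendsto (fun n => (S.average n fun k => φ n (k + i)) - S.average n (φ n)) atTop (𝓝 0) := by
  induction i with
  | zero => simp
  | succ i ih =>
    have hstep : Tendsto (fun n => (S.average n fun k => φ n (k + 1 + i)) -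
        S.average n fun k => φ n (k + i)) atTop (𝓝 0) := by
      have hlim := (tendsto_length_X_sub_one_mul_omegaPolyLE hA hPNT).mul_const M
      rw [zero_mul] at hlim
      refine squeeze_zero_norm (fun n => ?_) hlim
      have e : (S.average n fun k => φ n (k + 1 + i)) - (S.average n fun k => φ n (k + i)) =
          ((S.degreeLE n).card : ℂ)⁻¹ *
            ((X - 1) * S.omegaPolyLE n).pairing fun k => φ n (k + i) := by
        rw [sub_mul, one_mul, pairing_sub, pairing_X_mul, pairing_omegaPolyLE,
          pairing_omegaPolyLE, average, average, mul_sub]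
      rw [e, norm_mul, norm_inv, Complex.norm_natCast, div_mul_eq_mul_div, inv_mul_eq_div]
      exact div_le_div_of_nonneg_right (norm_pairing_le _ fun k => hφ n (k + i)) (by positivity)
    have := hstep.add ih
    rw [zero_add] at this
    refine this.congr fun n => ?_
    rw [sub_add_sub_cancel]
    simp only [add_assoc, add_comm 1 i]

theorem tendsto_average_mul_of_isUniquelyErgodic (hA : S.IsAxiomASharp c q η)
    (hPNT : S.HasClassicalPNT q η) {X : Type*} [MetricSpace X] [CompactSpace X]
    [MeasurableSpace X] [BorelSpace X] {μ : Measure X} {T : X → X} (hT : IsUniquelyErgodic μ T)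
    {F : ℝ → ℂ} (hF : UniformContinuous F) {M : ℝ} (hM : ∀ t, ‖F t‖ ≤ M) {I : ℂ}
    (hI : Tendsto (fun n => S.average n fun k => F (normalize n k)) atTop (𝓝 I))
    (x : X) {f : X → ℂ} (hf : Continuous f) :
    Tendsto (fun n => S.average n fun k => F (normalize n k) * f (T^[k] x)) atTop
      (𝓝 (I * ∫ y, f y ∂μ)) := by
  obtain ⟨B, hB⟩ := isCompact_univ.exists_bound_of_continuousOn hf.continuousOn
  replace hB : ∀ y, ‖f y‖ ≤ B := fun y => hB y (Set.mem_univ y)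
  have hB0 : 0 ≤ B := (norm_nonneg _).trans (hB x)
  have hM0 : 0 ≤ M := (norm_nonneg _).trans (hM 0)
  set φ : ℕ → ℕ → ℂ := fun n k => F (normalize n k) * f (T^[k] x) with hφ
  have hsq : Tendsto (fun n : ℕ => √(Real.log n)) atTop atTop :=
    Real.tendsto_sqrt_atTop.comp (Real.tendsto_log_atTop.comp tendsto_natCast_atTop_atTop)
  have hshift : ∀ i : ℕ, Tendsto (fun n => (S.average n fun k =>
      F (normalize n k) * f (T^[k + i] x)) - S.average n (φ n)) atTop (𝓝 0) := by
    intro i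
    have h1 := tendsto_average_shift_sub hA hPNT (φ := φ) (M := M * B) (fun n k => by
      rw [hφ, norm_mul]
      exact mul_le_mul (hM _) (hB _) (norm_nonneg _) hM0) i
    -- Shifting the argument moves the normalized value by `i / √(log n)`, so uniform continuity of
    -- `F` lets its weight stay unshifted.
    have h2 : Tendsto (fun n => (S.average n fun k => F (normalize n k) * f (T^[k + i] x)) -
        S.average n fun k => φ n (k + i)) atTop (𝓝 0) := by
      rw [Metric.tendsto_nhds]
      intro ε hε
      obtain ⟨δ, hδ, hFδ⟩ := Metric.uniformContinuous_iff.1 hF (ε / (2 * (B + 1))) (by positivity)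
      filter_upwards [(hsq.const_div_atTop (i : ℝ)).eventually_lt_const hδ] with n hn
      rw [dist_zero_right, ← average_sub]
      refine (S.norm_average_le (M := ε / (2 * (B + 1)) * B) fun k => ?_).trans_lt ?_
      · rw [hφ, ← sub_mul, norm_mul]
        refine mul_le_mul ?_ (hB _) (norm_nonneg _) (by positivity)
        rw [← dist_eq_norm]
        refine (hFδ ?_).le
        rw [dist_comm, Real.dist_eq, normalize, normalize, ← sub_div]
        have e : ((k + i : ℕ) : ℝ) - Real.log n - ((k : ℝ) - Real.log n) = i := by
          push_cast; ring
        rwa [e, abs_of_nonneg (by positivity)]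
      · rw [div_mul_eq_mul_div, div_lt_iff₀ (by positivity)]
        nlinarith
    have := h2.add h1
    rw [zero_add] at this
    exact this.congr fun n => sub_add_sub_cancel _ _ _
  have hmain : Tendsto (fun n => S.average n (φ n) -
      (S.average n fun k => F (normalize n k)) * ∫ y, f y ∂μ) atTop (𝓝 0) := by
    rw [Metric.tendsto_nhds]
    intro ε hε
    -- `N` is fixed before `n` grows, so only finitely many shifts are averaged.
    obtain ⟨N, hN, hNavg⟩ := hT.exists_norm_average_sub_integral_le hf
      (ε := ε / (2 * (M + 1))) (by positivity)
    have hNC : (N : ℂ) ≠ 0 := by exact_mod_cast hN.ne'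
    have hsum := (tendsto_finsetSum (range N) fun i _ => hshift i).const_mul (N : ℂ)⁻¹
    rw [sum_const_zero, mul_zero] at hsum
    have hev := (tendsto_iff_norm_sub_tendsto_zero.1 hsum).eventually_lt_const (half_pos hε)
    filter_upwards [hev] with n hn
    rw [sub_zero, sum_sub_distrib, sum_const, card_range, nsmul_eq_mul, mul_sub,
      inv_mul_cancel_left₀ hNC, ← average_sum, mul_comm, ← average_mul_right] at hn
    rw [dist_zero_right]
    set A := S.average n fun k =>
      (∑ i ∈ range N, F (normalize n k) * f (T^[k + i] x)) * (N : ℂ)⁻¹ with hAdef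
    have h3 : ‖A - (S.average n fun k => F (normalize n k)) * ∫ y, f y ∂μ‖ ≤
        M * (ε / (2 * (M + 1))) := by
      rw [hAdef, ← average_mul_right, ← average_sub]
      refine S.norm_average_le fun k => ?_
      have e : (∑ i ∈ range N, F (normalize n k) * f (T^[k + i] x)) * (N : ℂ)⁻¹ -
          F (normalize n k) * ∫ y, f y ∂μ = F (normalize n k) *
            ((N : ℂ)⁻¹ * ∑ i ∈ range N, f (T^[i] (T^[k] x)) - ∫ y, f y ∂μ) := by
        rw [← mul_sum]
        simp only [← Function.iterate_add_apply, add_comm k]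
        ring
      rw [e, norm_mul]
      exact mul_le_mul (hM _) (hNavg _) (norm_nonneg _) hM0
    have h4 : M * (ε / (2 * (M + 1))) ≤ ε / 2 := by
      rw [← mul_div_assoc, div_le_div_iff₀ (by positivity) two_pos]
      nlinarith
    calc _ = ‖(A - (S.average n fun k => F (normalize n k)) * ∫ y, f y ∂μ) -
          (A - S.average n (φ n))‖ := by congr 1; ring
      _ < ε := by
        refine (norm_sub_le _ _).trans_lt ?_
        linarith
  have := hmain.add (hI.mul_const (∫ y, f y ∂μ))
  rw [zero_add] at this
  exact this.congr fun n => sub_add_cancel _ _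

end AdditiveArithmeticalSemigroup

/-! ### Conclusion -/

theorem integral_gaussianReal_zero_one (F : ℝ → ℂ) :
    ∫ t, F t ∂(ProbabilityTheory.gaussianReal 0 1) =
      (1 / Real.sqrt (2 * Real.pi) : ℝ) * ∫ t : ℝ, F t * (Real.exp (-t ^ 2 / 2) : ℂ) := by
  rw [ProbabilityTheory.integral_gaussianReal_eq_integral_smul one_ne_zero, ← integral_const_mul]
  refine integral_congr_ae (Eventually.of_forall fun t => ?_)
  simp only [ProbabilityTheory.gaussianPDFReal, Complex.real_smul, NNReal.coe_one, mul_one,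
    sub_zero, one_div]
  push_cast
  ring
theorem theorem1p3 {G : Type*} [CommMonoid G] (S : AdditiveArithmeticalSemigroup G)
    (c q η : ℝ) (hA : S.IsAxiomASharp c q η) (hPNT : S.HasClassicalPNT q η)
    {X : Type*} [MetricSpace X] [CompactSpace X] [MeasurableSpace X] [BorelSpace X]
    (μ : Measure X) (T : X → X) (hT : IsUniquelyErgodic μ T) :
    (∀ F : ℝ → ℂ, Continuous F → HasCompactSupport F →
      ∀ (x : X) (f : X → ℂ), Continuous f →
        Tendsto
          (fun n : ℕ => (1 / ((S.degreeLE n).card : ℂ)) *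
            ∑ g ∈ S.degreeLE n,
              F (((S.bigOmega g : ℝ) - Real.log n) / Real.sqrt (Real.log n)) *
                f (T^[S.bigOmega g] x))
          atTop
          (𝓝 (((1 / Real.sqrt (2 * Real.pi) : ℝ) *
              ∫ t : ℝ, F t * (Real.exp (-t ^ 2 / 2) : ℂ)) * ∫ y, f y ∂μ))) ∧
    (∀ (x : X) (f : X → ℂ), Continuous f →
      Tendsto
        (fun n : ℕ => (1 / ((S.degreeLE n).card : ℂ)) *
          ∑ g ∈ S.degreeLE n, f (T^[S.bigOmega g] x))
        atTop
        (𝓝 (∫ y, f y ∂μ))) := by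
  -- Bounded uniformly continuous weights cover both claims: compactly supported continuous `F`, and
  -- `F = 1` for the unweighted limit.
  have key : ∀ F : ℝ → ℂ, UniformContinuous F → ∀ M, (∀ t, ‖F t‖ ≤ M) →
      ∀ (x : X) (f : X → ℂ), Continuous f →
        Tendsto (fun n : ℕ => S.average n fun k =>
          F (AdditiveArithmeticalSemigroup.normalize n k) * f (T^[k] x)) atTop
          (𝓝 ((∫ t, F t ∂(ProbabilityTheory.gaussianReal 0 1)) * ∫ y, f y ∂μ)) := by
    intro F hF M hM x f hf
    exact AdditiveArithmeticalSemigroup.tendsto_average_mul_of_isUniquelyErgodic hA hPNT hT hF hM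
      (AdditiveArithmeticalSemigroup.tendsto_sum_normalize_bigOmega hA hPNT
        (BoundedContinuousFunction.ofNormedAddCommGroup F hF.continuous M hM)) x hf
  refine ⟨fun F hFc hFs x f hf => ?_, fun x f hf => ?_⟩
  · obtain ⟨M, hM⟩ := hFs.exists_bound_of_continuous hFc
    rw [← integral_gaussianReal_zero_one]
    refine (key F (hFs.uniformContinuous_of_continuous hFc) M hM x f hf).congr fun n => ?_
    rw [one_div]
    rfl
  · have h := key (fun _ => 1) uniformContinuous_const 1 (by simp) x f hf
    simp only [integral_const, probReal_univ, one_smul, one_mul] at h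
    refine h.congr fun n => ?_
    rw [one_div]
    rfl
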